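/- Let $S_\infty$ be the Polish group of all permutations of $\mathbb N$ with the topology of pointwise convergence. For a class $\mathcal C$ of structures in a countable language, let $X_{\mathcal C}$ be the standard Borel space of the structures in $\mathcal C$ with domain $\mathbb N$ (a Borel subset of the product space of all interpretations of the language on $\mathbb N$), on which $S_\infty$ acts in a Borel way by transport of structure (the logic action). Its orbit equivalence relation is the isomorphism relation $\cong_{\mathcal C}$, and the stabilizer of $x\in X_{\mathcal C}$ is $\mathrm{Aut}(x)$. If a Polish group $G$ acts in a Borel way on standard Borel spaces $X$ and $Y$ with orbit equivalence relations $E_X$ and $E_Y$, then $E_X$ *SPB reduces* to $E_Y$, written $E_X\le_{\mathrm{SPB}}E_Y$, if there is a Borel map $f\colon X\to Y$ such that $x\mathrel{E_X}x'\iff f(x)\mathrel{E_Y}f(x')$ for all $x,x'\in X$ and such that the stabilizers $G_x$ and $G_{f(x)}$ are isomorphic groups for every $x\in X$. **Proposition.** Let $\cong_{\mathrm{Gr}}$, $\cong_{\mathrm{PO}}$, $\cong_{\mathrm{Smg}}$ and $\cong_{\mathrm{Rng}_1}$ be the isomorphism relations between countable (simple undirected) graphs, partial orders, semigroups, and (associative,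 not necessarily commutative) unital rings, respectively, where a countable structure is one with domain $\mathbb N$. Then $$\cong_{\mathrm{Gr}}\ \le_{\mathrm{SPB}}\ \cong_{\mathrm{PO}},\qquad \cong_{\mathrm{Gr}}\ \le_{\mathrm{SPB}}\ \cong_{\mathrm{Smg}},\qquad \cong_{\mathrm{Gr}}\ \le_{\mathrm{SPB}}\ \cong_{\mathrm{Rng}_1}.$$ -/

import Mathlib

namespace InvariantDST

/-! ### The Polish group `S_∞` of permutations of `ℕ` -/

/-- The topology of pointwise convergence on the group of permutations of `ℕ`. -/
instance instTopologicalSpacePerm : TopologicalSpace (Equiv.Perm ℕ) :=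
  TopologicalSpace.induced (fun σ : Equiv.Perm ℕ => (fun n => σ n : ℕ → ℕ)) inferInstance

/-- The Borel σ-algebra of `S_∞`. -/
instance instMeasurableSpacePerm : MeasurableSpace (Equiv.Perm ℕ) := borel _

instance instBorelSpacePerm : BorelSpace (Equiv.Perm ℕ) := ⟨rfl⟩

theorem continuous_perm_coe : Continuous (fun σ : Equiv.Perm ℕ => (fun n => σ n : ℕ → ℕ)) :=
  continuous_induced_dom

theorem continuous_perm_apply (n : ℕ) : Continuous (fun σ : Equiv.Perm ℕ => σ n) :=
  (continuous_apply n).comp continuous_perm_coe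

theorem continuous_perm_inv_apply (n : ℕ) : Continuous (fun σ : Equiv.Perm ℕ => σ⁻¹ n) := by
  refine continuous_discrete_rng.2 fun b => ?_
  have h : (fun σ : Equiv.Perm ℕ => σ⁻¹ n) ⁻¹' {b} = (fun σ : Equiv.Perm ℕ => σ b) ⁻¹' {n} := by
    ext σ
    simp only [Set.mem_preimage, Set.mem_singleton_iff, Equiv.Perm.inv_eq_iff_eq]
    exact eq_comm
  rw [h]
  exact (isOpen_discrete _).preimage (continuous_perm_apply b)

theorem continuous_perm_of {T : Type*} [TopologicalSpace T] {f : T → Equiv.Perm ℕ}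
    (h : ∀ n, Continuous fun t => f t n) : Continuous f :=
  continuous_induced_rng.2 (continuous_pi h)

theorem continuous_discrete_comp {T : Type*} [TopologicalSpace T] {f : T → ℕ → ℕ} {i : T → ℕ}
    (hf : Continuous f) (hi : Continuous i) : Continuous fun t => f t (i t) := by
  have h : Continuous fun p : ℕ × (ℕ → ℕ) => p.2 p.1 :=
    continuous_prod_of_discrete_left.2 fun n => continuous_apply n
  exact h.comp (hi.prodMk hf)

instance instIsTopologicalGroupPerm : IsTopologicalGroup (Equiv.Perm ℕ) where
  continuous_mul := continuous_perm_of fun n =>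
    continuous_discrete_comp (f := fun p : Equiv.Perm ℕ × Equiv.Perm ℕ => fun k => p.1 k)
      (i := fun p => p.2 n) (continuous_perm_coe.comp continuous_fst)
      ((continuous_perm_apply n).comp continuous_snd)
  continuous_inv := continuous_perm_of continuous_perm_inv_apply

instance instPolishSpacePerm : PolishSpace (Equiv.Perm ℕ) := by
  let F : Equiv.Perm ℕ → (ℕ → ℕ) × (ℕ → ℕ) := fun σ => (fun n => σ n, fun n => σ⁻¹ n)
  have hF : Continuous F :=
    continuous_perm_coe.prodMk (continuous_pi continuous_perm_inv_apply)
  have hind : Topology.IsInducing F := by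
    refine ⟨le_antisymm hF.le_induced ?_⟩
    change _ ≤ TopologicalSpace.induced _ _
    rw [show (fun σ : Equiv.Perm ℕ => (fun n => σ n : ℕ → ℕ)) = Prod.fst ∘ F from rfl,
      ← induced_compose]
    exact induced_mono continuous_fst.le_induced
  have hinj : Function.Injective F := fun σ τ h =>
    Equiv.ext fun n => congrFun (congrArg Prod.fst h) n
  have hrange : Set.range F =
      ⋂ n : ℕ, {p : (ℕ → ℕ) × (ℕ → ℕ) | p.1 (p.2 n) = n ∧ p.2 (p.1 n) = n} := by
    ext p
    simp only [Set.mem_range, Set.mem_iInter, Set.mem_ofPred_eq]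
    constructor
    · rintro ⟨σ, rfl⟩ n
      simp [F]
    · intro h
      exact ⟨⟨p.1, p.2, fun n => (h n).2, fun n => (h n).1⟩, rfl⟩
  have hclosed : IsClosed (Set.range F) := by
    rw [hrange]
    refine isClosed_iInter fun n => ?_
    have h1 : Continuous fun p : (ℕ → ℕ) × (ℕ → ℕ) => p.1 (p.2 n) :=
      continuous_discrete_comp continuous_fst ((continuous_apply n).comp continuous_snd)
    have h2 : Continuous fun p : (ℕ → ℕ) × (ℕ → ℕ) => p.2 (p.1 n) :=
      continuous_discrete_comp continuous_snd ((continuous_apply n).comp continuous_fst)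
    exact (isClosed_eq h1 continuous_const).inter (isClosed_eq h2 continuous_const)
  exact (Topology.IsClosedEmbedding.mk ⟨hind, hinj⟩ hclosed).polishSpace

/-! ### Stabilizer preserving Borel reductions -/

/-- For Borel actions of a Polish group `G` on standard Borel spaces `X` and `Y`, the orbit
equivalence relation of `X` *SPB reduces* to that of `Y`: there is a Borel map `f : X → Y` that
reduces the first relation to the second and such that the stabilizers of `x` and of `f x` are
isomorphic groups for every `x`. -/
def SPBReduces (G X Y : Type*)
    [Group G] [TopologicalSpace G] [IsTopologicalGroup G] [PolishSpace G]
    [MeasurableSpace G] [BorelSpace G]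
    [MeasurableSpace X] [StandardBorelSpace X] [MulAction G X] [MeasurableSMul₂ G X]
    [MeasurableSpace Y] [StandardBorelSpace Y] [MulAction G Y] [MeasurableSMul₂ G Y] : Prop :=
  ∃ f : X → Y, Measurable f ∧
    (∀ x y : X, MulAction.orbitRel G X x y ↔ MulAction.orbitRel G Y (f x) (f y)) ∧
    ∀ x : X, Nonempty (MulAction.stabilizer G x ≃* MulAction.stabilizer G (f x))

/-! ### Transport of relations and operations on `ℕ` along a permutation -/

/-- The image of a binary relation under a permutation of `ℕ`. -/
def permRel (σ : Equiv.Perm ℕ) (r : ℕ → ℕ → Prop) : ℕ → ℕ → Prop :=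
  fun a b => r (σ⁻¹ a) (σ⁻¹ b)

/-- The image of a binary operation under a permutation of `ℕ`. -/
def permOp₂ (σ : Equiv.Perm ℕ) (m : ℕ → ℕ → ℕ) : ℕ → ℕ → ℕ :=
  fun a b => σ (m (σ⁻¹ a) (σ⁻¹ b))

/-- The image of a unary operation under a permutation of `ℕ`. -/
def permOp₁ (σ : Equiv.Perm ℕ) (m : ℕ → ℕ) : ℕ → ℕ :=
  fun a => σ (m (σ⁻¹ a))

theorem measurable_eval₁ {Ω β : Type*} [MeasurableSpace Ω] [MeasurableSpace β]
    {r : Ω → ℕ → β} {i : Ω → ℕ} (hr : Measurable r) (hi : Measurable i) :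
    Measurable fun t => r t (i t) := by
  have h : Measurable fun p : (ℕ → β) × ℕ => p.1 p.2 :=
    measurable_from_prod_countable_left fun n => measurable_pi_apply n
  exact h.comp (hr.prodMk hi)

theorem measurable_eval₂ {Ω β : Type*} [MeasurableSpace Ω] [MeasurableSpace β]
    {r : Ω → ℕ → ℕ → β} {i j : Ω → ℕ} (hr : Measurable r) (hi : Measurable i)
    (hj : Measurable j) : Measurable fun t => r t (i t) (j t) :=
  measurable_eval₁ (measurable_eval₁ hr hi) hj

theorem measurable_perm_apply {Ω : Type*} [MeasurableSpace Ω] {s : Ω → Equiv.Perm ℕ} {i : Ω → ℕ}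
    (hs : Measurable s) (hi : Measurable i) : Measurable fun t => s t (i t) :=
  measurable_eval₁ (r := fun t n => s t n)
    (measurable_pi_lambda _ fun n => (continuous_perm_apply n).measurable.comp hs) hi

theorem measurable_permRel {Ω : Type*} [MeasurableSpace Ω] {s : Ω → Equiv.Perm ℕ}
    {r : Ω → ℕ → ℕ → Prop} (hs : Measurable s) (hr : Measurable r) :
    Measurable fun t => permRel (s t) (r t) :=
  measurable_pi_lambda _ fun _ => measurable_pi_lambda _ fun _ =>
    measurable_eval₂ (r := r) hr (measurable_perm_apply hs.inv measurable_const)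
      (measurable_perm_apply hs.inv measurable_const)

theorem measurable_permOp₂ {Ω : Type*} [MeasurableSpace Ω] {s : Ω → Equiv.Perm ℕ}
    {r : Ω → ℕ → ℕ → ℕ} (hs : Measurable s) (hr : Measurable r) :
    Measurable fun t => permOp₂ (s t) (r t) :=
  measurable_pi_lambda _ fun _ => measurable_pi_lambda _ fun _ =>
    measurable_perm_apply hs (measurable_eval₂ hr (measurable_perm_apply hs.inv measurable_const)
      (measurable_perm_apply hs.inv measurable_const))

theorem measurable_permOp₁ {Ω : Type*} [MeasurableSpace Ω] {s : Ω → Equiv.Perm ℕ}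
    {r : Ω → ℕ → ℕ} (hs : Measurable s) (hr : Measurable r) :
    Measurable fun t => permOp₁ (s t) (r t) :=
  measurable_pi_lambda _ fun _ =>
    measurable_perm_apply hs (measurable_eval₁ hr (measurable_perm_apply hs.inv measurable_const))

/-! ### Countable graphs -/

/-- The axioms of (simple, undirected) graphs with vertex set `ℕ`. -/
structure IsGraph (E : ℕ → ℕ → Prop) : Prop where
  symm : ∀ a b, E a b → E b a
  irrefl : ∀ a, ¬ E a a

/-- The space of countable graphs, i.e. of graphs with vertex set `ℕ`. -/
def GraphSpace : Type := {E : ℕ → ℕ → Prop // IsGraph E}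

/-- The σ-algebra induced by the product σ-algebra of `2^(ℕ × ℕ)`. -/
instance instMeasurableSpaceGraphSpace : MeasurableSpace GraphSpace :=
  inferInstanceAs (MeasurableSpace {E : ℕ → ℕ → Prop // IsGraph E})

theorem measurableSet_isGraph : MeasurableSet {E : ℕ → ℕ → Prop | IsGraph E} := by
  have h : {E : ℕ → ℕ → Prop | IsGraph E} =
      {E | (∀ a b, E a b → E b a) ∧ ∀ a, ¬ E a a} := by
    ext E
    exact ⟨fun h => ⟨h.1, h.2⟩, fun h => ⟨h.1, h.2⟩⟩
  rw [h]
  measurability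

instance instStandardBorelGraphSpace : StandardBorelSpace GraphSpace :=
  measurableSet_isGraph.standardBorel

/-- The logic action of `S_∞` on graphs. -/
instance instMulActionGraphSpace : MulAction (Equiv.Perm ℕ) GraphSpace where
  smul σ x := ⟨permRel σ x.1,
    ⟨fun _ _ h => x.2.symm _ _ h, fun _ h => x.2.irrefl _ h⟩⟩
  one_smul _ := rfl
  mul_smul _ _ _ := rfl

instance instMeasurableSMulGraphSpace : MeasurableSMul₂ (Equiv.Perm ℕ) GraphSpace where
  measurable_smul := Measurable.subtype_mk
    (measurable_permRel measurable_fst (measurable_subtype_coe.comp measurable_snd))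

/-- The orbit equivalence relation of the logic action is isomorphism. -/
theorem orbitRel_graphSpace_iff (x y : GraphSpace) :
    MulAction.orbitRel (Equiv.Perm ℕ) GraphSpace x y ↔
      ∃ σ : Equiv.Perm ℕ, ∀ a b, x.1 a b ↔ y.1 (σ a) (σ b) := by
  constructor
  · rintro ⟨σ, rfl⟩
    refine ⟨σ⁻¹, fun a b => ?_⟩
    rfl
  · rintro ⟨σ, h⟩
    refine ⟨σ⁻¹, Subtype.ext ?_⟩
    funext a b
    exact propext (h a b).symm

/-! ### Countable partial orders -/

/-- The space of countable (non-strict) partial orders, i.e. of partial orders of `ℕ`. -/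
def POSpace : Type := {r : ℕ → ℕ → Prop // IsPartialOrder ℕ r}

/-- The σ-algebra induced by the product σ-algebra of `2^(ℕ × ℕ)`. -/
instance instMeasurableSpacePOSpace : MeasurableSpace POSpace :=
  inferInstanceAs (MeasurableSpace {r : ℕ → ℕ → Prop // IsPartialOrder ℕ r})

theorem measurableSet_isPartialOrder :
    MeasurableSet {r : ℕ → ℕ → Prop | IsPartialOrder ℕ r} := by
  have h : {r : ℕ → ℕ → Prop | IsPartialOrder ℕ r} =
      {r | (∀ a, r a a) ∧ (∀ a b c, r a b → r b c → r a c) ∧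
        ∀ a b, r a b → r b a → a = b} := by
    ext r
    exact ⟨fun h => ⟨h.refl, h.trans, h.antisymm⟩,
      fun h => { refl := h.1, trans := h.2.1, antisymm := h.2.2 }⟩
  rw [h]
  measurability

instance instStandardBorelPOSpace : StandardBorelSpace POSpace :=
  measurableSet_isPartialOrder.standardBorel

/-- The logic action of `S_∞` on partial orders. -/
instance instMulActionPOSpace : MulAction (Equiv.Perm ℕ) POSpace where
  smul σ x := ⟨permRel σ x.1,
    { refl := fun _ => x.2.refl _
      trans := fun _ _ _ h k => x.2.trans _ _ _ h k
      antisymm := fun _ _ h k => (σ⁻¹).injective (x.2.antisymm _ _ h k) }⟩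
  one_smul _ := rfl
  mul_smul _ _ _ := rfl

instance instMeasurableSMulPOSpace : MeasurableSMul₂ (Equiv.Perm ℕ) POSpace where
  measurable_smul := Measurable.subtype_mk
    (measurable_permRel measurable_fst (measurable_subtype_coe.comp measurable_snd))

/-- The orbit equivalence relation of the logic action is isomorphism. -/
theorem orbitRel_poSpace_iff (x y : POSpace) :
    MulAction.orbitRel (Equiv.Perm ℕ) POSpace x y ↔
      ∃ σ : Equiv.Perm ℕ, ∀ a b, x.1 a b ↔ y.1 (σ a) (σ b) := by
  constructor
  · rintro ⟨σ, rfl⟩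
    refine ⟨σ⁻¹, fun a b => ?_⟩
    rfl
  · rintro ⟨σ, h⟩
    refine ⟨σ⁻¹, Subtype.ext ?_⟩
    funext a b
    exact propext (h a b).symm

/-! ### Countable semigroups -/

/-- The axiom of semigroups with domain `ℕ`. -/
structure IsSemigroupOp (m : ℕ → ℕ → ℕ) : Prop where
  assoc : ∀ a b c, m (m a b) c = m a (m b c)

/-- The space of countable semigroups, i.e. of semigroups with domain `ℕ`. -/
def SemigroupSpace : Type := {m : ℕ → ℕ → ℕ // IsSemigroupOp m}

/-- The σ-algebra induced by the product σ-algebra of `ℕ^(ℕ × ℕ)`. -/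
instance instMeasurableSpaceSemigroupSpace : MeasurableSpace SemigroupSpace :=
  inferInstanceAs (MeasurableSpace {m : ℕ → ℕ → ℕ // IsSemigroupOp m})

theorem measurableSet_isSemigroupOp : MeasurableSet {m : ℕ → ℕ → ℕ | IsSemigroupOp m} := by
  have h : {m : ℕ → ℕ → ℕ | IsSemigroupOp m} =
      ⋂ a, ⋂ b, ⋂ c, {m | m (m a b) c = m a (m b c)} := by
    ext m
    simp only [Set.mem_iInter]
    exact ⟨fun h => h.1, fun h => ⟨h⟩⟩
  rw [h]
  refine MeasurableSet.iInter fun a => MeasurableSet.iInter fun b => MeasurableSet.iInter fun c =>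
    measurableSet_eq_fun ?_ ?_
  · exact measurable_eval₂ measurable_id (measurable_eval₂ measurable_id measurable_const
      measurable_const) measurable_const
  · exact measurable_eval₂ measurable_id measurable_const (measurable_eval₂ measurable_id
      measurable_const measurable_const)

instance instStandardBorelSemigroupSpace : StandardBorelSpace SemigroupSpace :=
  measurableSet_isSemigroupOp.standardBorel

/-- The logic action of `S_∞` on semigroups. -/
instance instMulActionSemigroupSpace : MulAction (Equiv.Perm ℕ) SemigroupSpace where
  smul σ x := ⟨permOp₂ σ x.1, ⟨fun a b c => by simp [permOp₂, x.2.assoc]⟩⟩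
  one_smul _ := rfl
  mul_smul _ _ _ := rfl

instance instMeasurableSMulSemigroupSpace : MeasurableSMul₂ (Equiv.Perm ℕ) SemigroupSpace where
  measurable_smul := Measurable.subtype_mk
    (measurable_permOp₂ measurable_fst (measurable_subtype_coe.comp measurable_snd))

/-- The orbit equivalence relation of the logic action is isomorphism. -/
theorem orbitRel_semigroupSpace_iff (x y : SemigroupSpace) :
    MulAction.orbitRel (Equiv.Perm ℕ) SemigroupSpace x y ↔
      ∃ σ : Equiv.Perm ℕ, ∀ a b, σ (x.1 a b) = y.1 (σ a) (σ b) := by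
  constructor
  · rintro ⟨σ, rfl⟩
    refine ⟨σ⁻¹, fun a b => ?_⟩
    change σ⁻¹ (σ (y.1 (σ⁻¹ a) (σ⁻¹ b))) = _
    simp
  · rintro ⟨σ, h⟩
    refine ⟨σ⁻¹, Subtype.ext ?_⟩
    funext a b
    change σ⁻¹ (y.1 (σ a) (σ b)) = _
    rw [← h]
    simp

/-! ### Countable unital rings -/

/-- An interpretation with domain `ℕ` of the language `{+, ·, -, 0, 1}` of unital rings, coded as
the tuple `(+, ·, -, 0, 1)`. -/
abbrev RingCode : Type := (ℕ → ℕ → ℕ) × (ℕ → ℕ → ℕ) × (ℕ → ℕ) × ℕ × ℕ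

namespace RingCode

/-- The addition. -/
def add (x : RingCode) : ℕ → ℕ → ℕ := x.1

/-- The multiplication. -/
def mul (x : RingCode) : ℕ → ℕ → ℕ := x.2.1

/-- The negation. -/
def neg (x : RingCode) : ℕ → ℕ := x.2.2.1

/-- The zero element. -/
def zero (x : RingCode) : ℕ := x.2.2.2.1

/-- The unit element. -/
def one (x : RingCode) : ℕ := x.2.2.2.2

end RingCode

/-- The axioms of (associative, not necessarily commutative) unital rings with domain `ℕ`. -/
structure IsUnitalRing (x : RingCode) : Prop where
  add_assoc : ∀ a b c, x.add (x.add a b) c = x.add a (x.add b c)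
  add_comm : ∀ a b, x.add a b = x.add b a
  zero_add : ∀ a, x.add x.zero a = a
  neg_add_cancel : ∀ a, x.add (x.neg a) a = x.zero
  mul_assoc : ∀ a b c, x.mul (x.mul a b) c = x.mul a (x.mul b c)
  one_mul : ∀ a, x.mul x.one a = a
  mul_one : ∀ a, x.mul a x.one = a
  left_distrib : ∀ a b c, x.mul a (x.add b c) = x.add (x.mul a b) (x.mul a c)
  right_distrib : ∀ a b c, x.mul (x.add a b) c = x.add (x.mul a c) (x.mul b c)

/-- The space of countable unital rings, i.e. of unital rings with domain `ℕ`. -/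
def RingSpace : Type := {x : RingCode // IsUnitalRing x}

/-- The σ-algebra induced by the product σ-algebra of the space of interpretations. -/
instance instMeasurableSpaceRingSpace : MeasurableSpace RingSpace :=
  inferInstanceAs (MeasurableSpace {x : RingCode // IsUnitalRing x})

theorem measurableSet_isUnitalRing : MeasurableSet {x : RingCode | IsUnitalRing x} := by
  have hadd : Measurable RingCode.add := measurable_fst
  have hmul : Measurable RingCode.mul := measurable_fst.comp measurable_snd
  have hneg : Measurable RingCode.neg :=
    measurable_fst.comp (measurable_snd.comp measurable_snd)
  have hzero : Measurable RingCode.zero :=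
    measurable_fst.comp (measurable_snd.comp (measurable_snd.comp measurable_snd))
  have hone : Measurable RingCode.one :=
    measurable_snd.comp (measurable_snd.comp (measurable_snd.comp measurable_snd))
  have hc : ∀ n : ℕ, Measurable fun _ : RingCode => n := fun _ => measurable_const
  have A : ∀ {i j : RingCode → ℕ}, Measurable i → Measurable j →
      Measurable fun x : RingCode => x.add (i x) (j x) := fun hi hj => measurable_eval₂ hadd hi hj
  have M : ∀ {i j : RingCode → ℕ}, Measurable i → Measurable j →
      Measurable fun x : RingCode => x.mul (i x) (j x) := fun hi hj => measurable_eval₂ hmul hi hj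
  have h : {x : RingCode | IsUnitalRing x} =
      ⋂ a, ⋂ b, ⋂ c,
        ({x : RingCode | x.add (x.add a b) c = x.add a (x.add b c)} ∩
        ({x | x.add a b = x.add b a} ∩
        ({x | x.add x.zero a = a} ∩
        ({x | x.add (x.neg a) a = x.zero} ∩
        ({x | x.mul (x.mul a b) c = x.mul a (x.mul b c)} ∩
        ({x | x.mul x.one a = a} ∩
        ({x | x.mul a x.one = a} ∩
        ({x | x.mul a (x.add b c) = x.add (x.mul a b) (x.mul a c)} ∩
        {x | x.mul (x.add a b) c = x.add (x.mul a c) (x.mul b c)})))))))) := by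
    ext x
    simp only [Set.mem_iInter, Set.mem_inter_iff, Set.mem_ofPred_eq]
    constructor
    · intro h a b c
      exact ⟨h.1 a b c, h.2 a b, h.3 a, h.4 a, h.5 a b c, h.6 a, h.7 a, h.8 a b c, h.9 a b c⟩
    · intro h
      exact ⟨fun a b c => (h a b c).1, fun a b => (h a b 0).2.1, fun a => (h a 0 0).2.2.1,
        fun a => (h a 0 0).2.2.2.1, fun a b c => (h a b c).2.2.2.2.1,
        fun a => (h a 0 0).2.2.2.2.2.1, fun a => (h a 0 0).2.2.2.2.2.2.1,
        fun a b c => (h a b c).2.2.2.2.2.2.2.1, fun a b c => (h a b c).2.2.2.2.2.2.2.2⟩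
  rw [h]
  refine MeasurableSet.iInter fun a => MeasurableSet.iInter fun b => MeasurableSet.iInter fun c =>
    ?_
  refine (measurableSet_eq_fun (A (A (hc a) (hc b)) (hc c)) (A (hc a) (A (hc b) (hc c)))).inter
    ((measurableSet_eq_fun (A (hc a) (hc b)) (A (hc b) (hc a))).inter
    ((measurableSet_eq_fun (A hzero (hc a)) (hc a)).inter
    ((measurableSet_eq_fun (A (measurable_eval₁ hneg (hc a)) (hc a)) hzero).inter
    ((measurableSet_eq_fun (M (M (hc a) (hc b)) (hc c)) (M (hc a) (M (hc b) (hc c)))).inter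
    ((measurableSet_eq_fun (M hone (hc a)) (hc a)).inter
    ((measurableSet_eq_fun (M (hc a) hone) (hc a)).inter
    ((measurableSet_eq_fun (M (hc a) (A (hc b) (hc c)))
      (A (M (hc a) (hc b)) (M (hc a) (hc c)))).inter
    (measurableSet_eq_fun (M (A (hc a) (hc b)) (hc c))
      (A (M (hc a) (hc c)) (M (hc b) (hc c)))))))))))

instance instStandardBorelRingSpace : StandardBorelSpace RingSpace :=
  measurableSet_isUnitalRing.standardBorel

/-- The image of an interpretation of the language of unital rings under a permutation of `ℕ`. -/
def permRing (σ : Equiv.Perm ℕ) (x : RingCode) : RingCode :=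
  (permOp₂ σ x.add, permOp₂ σ x.mul, permOp₁ σ x.neg, σ x.zero, σ x.one)

theorem isUnitalRing_permRing (σ : Equiv.Perm ℕ) {x : RingCode} (hx : IsUnitalRing x) :
    IsUnitalRing (permRing σ x) where
  add_assoc a b c := by
    change permOp₂ σ x.add (permOp₂ σ x.add a b) c = permOp₂ σ x.add a (permOp₂ σ x.add b c)
    simp [permOp₂, hx.add_assoc]
  add_comm a b := by
    change permOp₂ σ x.add a b = permOp₂ σ x.add b a
    simp [permOp₂, hx.add_comm (σ.symm a)]
  zero_add a := by
    change permOp₂ σ x.add (σ x.zero) a = a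
    simp [permOp₂, hx.zero_add]
  neg_add_cancel a := by
    change permOp₂ σ x.add (permOp₁ σ x.neg a) a = σ x.zero
    simp [permOp₂, permOp₁, hx.neg_add_cancel]
  mul_assoc a b c := by
    change permOp₂ σ x.mul (permOp₂ σ x.mul a b) c = permOp₂ σ x.mul a (permOp₂ σ x.mul b c)
    simp [permOp₂, hx.mul_assoc]
  one_mul a := by
    change permOp₂ σ x.mul (σ x.one) a = a
    simp [permOp₂, hx.one_mul]
  mul_one a := by
    change permOp₂ σ x.mul a (σ x.one) = a
    simp [permOp₂, hx.mul_one]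
  left_distrib a b c := by
    change permOp₂ σ x.mul a (permOp₂ σ x.add b c) =
      permOp₂ σ x.add (permOp₂ σ x.mul a b) (permOp₂ σ x.mul a c)
    simp [permOp₂, hx.left_distrib]
  right_distrib a b c := by
    change permOp₂ σ x.mul (permOp₂ σ x.add a b) c =
      permOp₂ σ x.add (permOp₂ σ x.mul a c) (permOp₂ σ x.mul b c)
    simp [permOp₂, hx.right_distrib]

/-- The logic action of `S_∞` on unital rings. -/
instance instMulActionRingSpace : MulAction (Equiv.Perm ℕ) RingSpace where
  smul σ x := ⟨permRing σ x.1, isUnitalRing_permRing σ x.2⟩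
  one_smul _ := rfl
  mul_smul _ _ _ := rfl

instance instMeasurableSMulRingSpace : MeasurableSMul₂ (Equiv.Perm ℕ) RingSpace where
  measurable_smul := by
    have hx : Measurable fun p : Equiv.Perm ℕ × RingSpace => (p.2.1 : RingCode) :=
      measurable_subtype_coe.comp measurable_snd
    exact Measurable.subtype_mk
      ((measurable_permOp₂ measurable_fst hx.fst).prodMk
      ((measurable_permOp₂ measurable_fst hx.snd.fst).prodMk
      ((measurable_permOp₁ measurable_fst hx.snd.snd.fst).prodMk
      ((measurable_perm_apply measurable_fst hx.snd.snd.snd.fst).prodMk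
      (measurable_perm_apply measurable_fst hx.snd.snd.snd.snd)))))

/-- The orbit equivalence relation of the logic action is isomorphism. -/
theorem orbitRel_ringSpace_iff (x y : RingSpace) :
    MulAction.orbitRel (Equiv.Perm ℕ) RingSpace x y ↔
      ∃ σ : Equiv.Perm ℕ, (∀ a b, σ (x.1.add a b) = y.1.add (σ a) (σ b)) ∧
        (∀ a b, σ (x.1.mul a b) = y.1.mul (σ a) (σ b)) ∧
        (∀ a, σ (x.1.neg a) = y.1.neg (σ a)) ∧ σ x.1.zero = y.1.zero ∧ σ x.1.one = y.1.one := by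
  constructor
  · rintro ⟨σ, rfl⟩
    refine ⟨σ⁻¹, fun a b => ?_, fun a b => ?_, fun a => ?_, ?_, ?_⟩
    · change σ⁻¹ (σ (y.1.add (σ⁻¹ a) (σ⁻¹ b))) = _
      simp
    · change σ⁻¹ (σ (y.1.mul (σ⁻¹ a) (σ⁻¹ b))) = _
      simp
    · change σ⁻¹ (σ (y.1.neg (σ⁻¹ a))) = _
      simp
    · change σ⁻¹ (σ y.1.zero) = _
      simp
    · change σ⁻¹ (σ y.1.one) = _
      simp
  · rintro ⟨σ, hadd, hmul, hneg, hzero, hone⟩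
    refine ⟨σ⁻¹, Subtype.ext ?_⟩
    change permRing σ⁻¹ y.1 = (x.1.add, x.1.mul, x.1.neg, x.1.zero, x.1.one)
    simp only [permRing, Prod.mk.injEq]
    refine ⟨?_, ?_, ?_, ?_, ?_⟩
    · funext a b
      change σ⁻¹ (y.1.add (σ a) (σ b)) = _
      rw [← hadd]
      simp
    · funext a b
      change σ⁻¹ (y.1.mul (σ a) (σ b)) = _
      rw [← hmul]
      simp
    · funext a
      change σ⁻¹ (y.1.neg (σ a)) = _
      rw [← hneg]
      simp
    · rw [← hzero]
      simp
    · rw [← hone]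
      simp

end InvariantDST

namespace InvariantDST

/-! ### Reductions given by full and faithful constructions -/

/-! Each reduction is a construction that is full and faithful on isomorphisms. A graph on `ℕ` is
coded by a structure on a fixed countable set `D` on which `S_∞` acts faithfully, so that the
isomorphisms between coded structures are exactly the permutations of `D` induced by isomorphisms of
the graphs. After `D` is identified with `ℕ`, the induced homomorphism `S_∞ → S_∞` gives both the
equivalence of orbit relations and, by restriction, an isomorphism of stabilizers. Each entry of the
coded structure depends on finitely many edges, so the construction is Borel. The substance is
fullness: vertices and edges have to be definable in the coded structure.

Partial orders: the pairs are the maximal elements and the remaining elements form rigid chains, one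
per vertex. Below a pair, the top level of a chain marks the first vertex, the bottom level marks
both vertices, and the middle level records adjacency.

Semigroups: all triple products vanish, so associativity is free. The vertices are the elements with
nonzero square, and a product of two vertices records adjacency.

Rings: the ring is a ring of integer functions on pairs, vertices and a point at infinity. The atoms
`25 · 1_a` and `50 · 1_p` are recognized by `q² = n q`, minimality and, for pairs, annihilation of
the vertex atoms (`mem_range_vertAtom_iff`, `mem_range_pairAtom_iff`). Hence a ring isomorphism
permutes vertices and pairs and preserves values. A function with value 10 at the pair `(a, b)`, and
0 at infinity and at the other pairs, has vertex values congruent to `10 (1_a + k 1_b)` modulo 25.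
This determines `1_a + k 1_b` modulo 5, and so `a`, `b` and the weight `k`, which is 2 or 3
according to adjacency (`eq_of_weights`). -/

theorem spbReduces_of_monoidHom {G X Y : Type*}
    [Group G] [TopologicalSpace G] [IsTopologicalGroup G] [PolishSpace G]
    [MeasurableSpace G] [BorelSpace G]
    [MeasurableSpace X] [StandardBorelSpace X] [MulAction G X] [MeasurableSMul₂ G X]
    [MeasurableSpace Y] [StandardBorelSpace Y] [MulAction G Y] [MeasurableSMul₂ G Y]
    (f : X → Y) (hf : Measurable f) (Φ : G →* G) (hΦ : Function.Injective Φ)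
    (hiff : ∀ g x y, Φ g • f x = f y ↔ g • x = y)
    (hfull : ∀ t x y, t • f x = f y → ∃ g, Φ g = t) : SPBReduces G X Y := by
  refine ⟨f, hf, fun x y => ?_, fun x => ?_⟩
  · constructor
    · rintro ⟨g, hg⟩
      exact ⟨Φ g, (hiff g y x).2 hg⟩
    · rintro ⟨t, ht⟩
      obtain ⟨g, rfl⟩ := hfull t y x ht
      exact ⟨g, (hiff g y x).1 ht⟩
  · let Ψ : MulAction.stabilizer G x →* MulAction.stabilizer G (f x) :=
      (Φ.comp (MulAction.stabilizer G x).subtype).codRestrict _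
        fun g => (hiff g x x).2 g.2
    refine ⟨MulEquiv.ofBijective Ψ ⟨fun g h hgh => ?_, fun t => ?_⟩⟩
    · exact Subtype.ext (hΦ (congrArg Subtype.val hgh))
    · obtain ⟨g, hg⟩ := hfull t x x t.2
      refine ⟨⟨g, (hiff g x x).1 ?_⟩, Subtype.ext hg⟩
      rw [hg]
      exact t.2

/-- A reduction of a logic action given by structures on a countable type `D` on which `S_∞` acts
faithfully: `Iso x y φ` says that `φ` is an isomorphism between the structures of `x` and `y`. -/
theorem spbReduces_of_structure {X Y D : Type*}
    [MeasurableSpace X] [StandardBorelSpace X] [MulAction (Equiv.Perm ℕ) X]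
    [MeasurableSMul₂ (Equiv.Perm ℕ) X]
    [MeasurableSpace Y] [StandardBorelSpace Y] [MulAction (Equiv.Perm ℕ) Y]
    [MeasurableSMul₂ (Equiv.Perm ℕ) Y]
    (e : D ≃ ℕ) (f : X → Y) (hf : Measurable f) (Ψ : Equiv.Perm ℕ →* Equiv.Perm D)
    (hΨ : Function.Injective Ψ) (Iso : X → X → Equiv.Perm D → Prop)
    (hIso : ∀ x y φ, e.permCongr φ • f x = f y ↔ Iso x y φ)
    (hiff : ∀ σ x y, Iso x y (Ψ σ) ↔ σ • x = y)
    (hfull : ∀ φ x y, Iso x y φ → ∃ σ, Ψ σ = φ) : SPBReduces (Equiv.Perm ℕ) X Y := by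
  refine spbReduces_of_monoidHom f hf (e.permCongrHom.toMonoidHom.comp Ψ)
    (e.permCongrHom.injective.comp hΨ) (fun g x y => (hIso x y (Ψ g)).trans (hiff g x y))
    fun t x y h => ?_
  obtain ⟨φ, rfl⟩ := e.permCongr.surjective t
  obtain ⟨σ, rfl⟩ := hfull φ x y ((hIso x y φ).1 h)
  exact ⟨σ, rfl⟩

/-- A permutation that preserves the range of an injection induces a permutation. -/
theorem exists_perm_of_range {V D D' : Type*} {i : V → D} {i' : V → D'}
    (hi : Function.Injective i) (hi' : Function.Injective i') (φ : D ≃ D')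
    (h : ∀ d, d ∈ Set.range i ↔ φ d ∈ Set.range i') :
    ∃ σ : Equiv.Perm V, ∀ a, φ (i a) = i' (σ a) := by
  choose s hs using fun a => (h (i a)).1 ⟨a, rfl⟩
  refine ⟨Equiv.ofBijective s ⟨fun a b hab => ?_, fun b => ?_⟩, fun a => (hs a).symm⟩
  · exact hi (φ.injective (by rw [← hs, ← hs, hab]))
  · obtain ⟨a, ha⟩ := (h (φ.symm (i' b))).2 (by simp)
    exact ⟨a, hi' (by rw [hs, ha]; simp)⟩

theorem smul_graphSpace_eq_iff (σ : Equiv.Perm ℕ) (x y : GraphSpace) :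
    σ • x = y ↔ ∀ a b, x.1 a b ↔ y.1 (σ a) (σ b) := by
  constructor
  · rintro rfl a b
    change _ ↔ x.1 (σ⁻¹ (σ a)) (σ⁻¹ (σ b))
    simp
  · intro h
    refine Subtype.ext (funext fun a => funext fun b => propext ?_)
    change x.1 (σ⁻¹ a) (σ⁻¹ b) ↔ _
    rw [h]
    simp

/-- A function on the space of graphs that depends on finitely many pairs only is Borel. -/
theorem measurable_of_finite_dependence {β : Type*} [MeasurableSpace β] (F : GraphSpace → β)
    (s : Finset (ℕ × ℕ))
    (h : ∀ x y : GraphSpace, (∀ p ∈ s, x.1 p.1 p.2 ↔ y.1 p.1 p.2) → F x = F y) :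
    Measurable F := by
  let ρ : GraphSpace → s → Prop := fun x p => x.1 p.1.1 p.1.2
  have hρ : Measurable ρ := measurable_pi_lambda _ fun p =>
    (measurable_pi_apply p.1.2).comp ((measurable_pi_apply p.1.1).comp measurable_subtype_coe)
  -- `F` factors through the finite set of truth assignments on `s`, where every function is
  -- measurable. The value at the empty graph only fills in assignments realized by no graph.
  have hF : F = Function.extend ρ F (fun _ => F ⟨fun _ _ => False, ⟨by simp, by simp⟩⟩) ∘ ρ := by
    funext x
    refine (Function.FactorsThrough.extend_apply (fun x y hxy => h x y fun p hp => ?_) _ x).symm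
    exact iff_of_eq (congrFun hxy ⟨p, hp⟩)
  rw [hF]
  exact (measurable_of_finite _).comp hρ

/-! ### Graphs as partial orders -/

/-- The partial order of a graph: every vertex `a` is a chain `a₀ < a₁ < a₂`, and the pair `(a, b)`
lies above the chain of `a`, above `b₀`, and above `b₁` if `a` and `b` are adjacent. -/
inductive GraphLE (E : ℕ → ℕ → Prop) : (ℕ × Fin 3) ⊕ (ℕ × ℕ) → (ℕ × Fin 3) ⊕ (ℕ × ℕ) → Prop
  | chain (a : ℕ) {i j : Fin 3} (h : i ≤ j) : GraphLE E (.inl (a, i)) (.inl (a, j))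
  | fst (a b : ℕ) (i : Fin 3) : GraphLE E (.inl (a, i)) (.inr (a, b))
  | snd_zero (a b : ℕ) : GraphLE E (.inl (b, 0)) (.inr (a, b))
  | snd_one {a b : ℕ} (h : E a b) : GraphLE E (.inl (b, 1)) (.inr (a, b))
  | refl (p : ℕ × ℕ) : GraphLE E (.inr p) (.inr p)

namespace GraphLE

variable {E E' : ℕ → ℕ → Prop}

theorem inl_inl {a b : ℕ} {i j : Fin 3} :
    GraphLE E (.inl (a, i)) (.inl (b, j)) ↔ a = b ∧ i ≤ j := by
  constructor
  · rintro ⟨⟩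
    exact ⟨rfl, ‹_›⟩
  · rintro ⟨rfl, h⟩
    exact chain a h

theorem inl_inr {a b c : ℕ} {i : Fin 3} :
    GraphLE E (.inl (c, i)) (.inr (a, b)) ↔ c = a ∨ c = b ∧ (i = 0 ∨ i = 1 ∧ E a b) := by
  constructor
  · rintro ⟨⟩ <;> simp_all
  · rintro (rfl | ⟨rfl, rfl | ⟨rfl, h⟩⟩)
    exacts [fst _ _ _, snd_zero _ _, snd_one h]

theorem inr_inr {p q : ℕ × ℕ} : GraphLE E (.inr p) (.inr q) ↔ p = q := by
  constructor
  · rintro ⟨⟩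
    rfl
  · rintro rfl
    exact refl p

theorem not_inr_inl {p : ℕ × ℕ} {q : ℕ × Fin 3} : ¬ GraphLE E (.inr p) (.inl q) := by
  rintro ⟨⟩

/-- Transitivity comes down to the fact that the levels of a vertex lying below a given pair form an
initial segment of `{0, 1, 2}`. -/
theorem isPartialOrder (E : ℕ → ℕ → Prop) : IsPartialOrder _ (GraphLE E) where
  refl := by
    rintro (⟨a, i⟩ | p)
    exacts [chain a le_rfl, refl p]
  trans := by
    rintro (⟨a, i⟩ | ⟨a, b⟩) (⟨c, j⟩ | ⟨c, d⟩) (⟨e, k⟩ | ⟨e, f⟩) <;>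
      simp only [inl_inl, inl_inr, inr_inr, not_inr_inl, Prod.mk.injEq, false_imp_iff,
        imp_false, imp_true_iff, not_false_eq_true]
    · rintro ⟨rfl, h⟩ ⟨rfl, h'⟩
      exact ⟨rfl, h.trans h'⟩
    · rintro ⟨rfl, h⟩ (rfl | ⟨rfl, rfl | ⟨rfl, h'⟩⟩)
      · exact .inl rfl
      · exact .inr ⟨rfl, .inl (le_antisymm h (Fin.zero_le _))⟩
      · refine .inr ⟨rfl, ?_⟩
        rcases Fin.le_def.1 h |>.lt_or_eq with h | h
        · exact .inl (Fin.ext (by simpa using h))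
        · exact .inr ⟨Fin.ext h, h'⟩
    · rintro h ⟨rfl, rfl⟩
      exact h
    · rintro ⟨rfl, rfl⟩ h
      exact h
  antisymm := by
    rintro (⟨a, i⟩ | p) (⟨c, j⟩ | q) <;>
      simp only [inl_inl, inr_inr, not_inr_inl, false_imp_iff, imp_true_iff]
    · rintro ⟨rfl, h⟩ ⟨-, h'⟩
      rw [le_antisymm h h']
    · rintro rfl -
      rfl

/-- The action of the permutations of the vertices on the elements of the partial order. -/
def permHom : Equiv.Perm ℕ →* Equiv.Perm ((ℕ × Fin 3) ⊕ (ℕ × ℕ)) where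
  toFun σ := (σ.prodCongr (Equiv.refl _)).sumCongr (σ.prodCongr σ)
  map_one' := by ext (_ | _) <;> rfl
  map_mul' _ _ := by ext (_ | _) <;> rfl

theorem permHom_injective : Function.Injective permHom := fun σ τ h => Equiv.ext fun n => by
  simpa [permHom] using DFunLike.congr_fun h (.inl (n, 0))

theorem permHom_inl (σ : Equiv.Perm ℕ) (a : ℕ) (i : Fin 3) :
    permHom σ (.inl (a, i)) = .inl (σ a, i) := rfl

theorem permHom_inr (σ : Equiv.Perm ℕ) (a b : ℕ) :
    permHom σ (.inr (a, b)) = .inr (σ a, σ b) := rfl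

/-- The diagonal is excluded because `(a, a)` lies above the whole chain of `a` whatever `E` is.
Irreflexivity makes up for it. -/
theorem inl_one_inr {a b : ℕ} (h : a ≠ b) :
    GraphLE E (.inl (b, 1)) (.inr (a, b)) ↔ E a b := by
  simp [inl_inr, h.symm]

theorem permHom_iff (hE : ∀ a, ¬ E a a) (hE' : ∀ a, ¬ E' a a) (σ : Equiv.Perm ℕ) :
    (∀ p q, GraphLE E p q ↔ GraphLE E' (permHom σ p) (permHom σ q)) ↔
      ∀ a b, E a b ↔ E' (σ a) (σ b) := by
  constructor
  · intro h a b
    rcases eq_or_ne a b with rfl | hab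
    · simp [hE, hE']
    · rw [← inl_one_inr (E := E) hab, ← inl_one_inr (E := E') (σ.injective.ne hab)]
      exact h _ _
  · rintro h (⟨a, i⟩ | ⟨a, b⟩) (⟨c, j⟩ | ⟨c, d⟩) <;>
      simp [permHom_inl, permHom_inr, inl_inl, inl_inr, inr_inr, not_inr_inl, h]

/-- The right-hand side says that `d` is not maximal, so every isomorphism respects the division
into chain elements and pairs. The pair `(a, a)` witnesses that no element of the chain of `a` is
maximal. -/
theorem mem_range_inl_iff (d : (ℕ × Fin 3) ⊕ (ℕ × ℕ)) :
    d ∈ Set.range Sum.inl ↔ ∃ q, q ≠ d ∧ GraphLE E d q := by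
  rcases d with ⟨a, i⟩ | p
  · exact iff_of_true ⟨_, rfl⟩ ⟨.inr (a, a), by simp, fst a a i⟩
  · refine iff_of_false (by simp) ?_
    rintro ⟨_ | q, hq, h⟩
    · exact not_inr_inl h
    · exact hq (congrArg Sum.inr (inr_inr.1 h).symm)

theorem exists_permHom_eq (φ : Equiv.Perm ((ℕ × Fin 3) ⊕ (ℕ × ℕ)))
    (hφ : ∀ p q, GraphLE E p q ↔ GraphLE E' (φ p) (φ q)) : ∃ σ, permHom σ = φ := by
  have hl : ∀ d, d ∈ Set.range Sum.inl ↔ φ d ∈ Set.range Sum.inl := fun d => by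
    rw [mem_range_inl_iff (E := E), mem_range_inl_iff (E := E'), φ.exists_congr_left]
    refine exists_congr fun q => ?_
    rw [hφ, φ.apply_symm_apply, Ne, Ne, φ.symm_apply_eq]
  obtain ⟨π, hπ⟩ := exists_perm_of_range Sum.inl_injective Sum.inl_injective φ hl
  obtain ⟨ρ, hρ⟩ := exists_perm_of_range Sum.inr_injective Sum.inr_injective φ fun d => by
    rw [← Set.compl_range_inl]
    exact (hl d).not
  have hπle : ∀ x y : ℕ × Fin 3,
      (x.1 = y.1 ∧ x.2 ≤ y.2) ↔ ((π x).1 = (π y).1 ∧ (π x).2 ≤ (π y).2) := fun x y => by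
    have := hφ (.inl x) (.inl y)
    rw [hπ, hπ] at this
    exact inl_inl.symm.trans (this.trans inl_inl)
  have hlt : ∀ (a : ℕ) {i j : Fin 3}, i < j → (π (a, i)).2 < (π (a, j)).2 := fun a i j hij => by
    have h1 := (hπle (a, i) (a, j)).1 ⟨rfl, hij.le⟩
    refine lt_of_le_of_ne h1.2 fun h2 => hij.ne ?_
    simpa using π.injective (Prod.ext h1.1 h2)
  -- A strictly increasing self-map of a chain of three elements is the identity.
  have hsnd : ∀ x, (π x).2 = x.2 := by
    rintro ⟨a, i⟩
    have h1 := hlt a (i := 0) (j := 1) (by decide)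
    have h2 := hlt a (i := 1) (j := 2) (by decide)
    simp only [Fin.lt_def] at h1 h2
    fin_cases i <;> simp only [Fin.ext_iff] <;> simp at * <;> omega
  obtain ⟨σ, hσ⟩ := exists_perm_of_range (i := fun a : ℕ => (a, (0 : Fin 3)))
    (i' := fun a : ℕ => (a, (0 : Fin 3))) (Prod.mk_left_injective 0) (Prod.mk_left_injective 0) π
    (by rintro ⟨a, i⟩; simp [Prod.ext_iff, hsnd, eq_comm])
  have hinl : ∀ a i, φ (.inl (a, i)) = .inl (σ a, i) := fun a i => by
    have h := ((hπle (a, 0) (a, i)).1 ⟨rfl, Fin.zero_le _⟩).1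
    rw [hσ] at h
    rw [hπ]
    exact congrArg Sum.inl (Prod.ext h.symm (hsnd (a, i)))
  have hle : ∀ c i a b, GraphLE E (.inl (c, i)) (.inr (a, b)) ↔
      GraphLE E' (.inl (σ c, i)) (.inr (ρ (a, b))) := fun c i a b => by
    rw [hφ, hinl, hρ]
  refine ⟨σ, Equiv.ext ?_⟩
  rintro (⟨a, i⟩ | ⟨a, b⟩)
  · rw [hinl, permHom_inl]
  · rw [hρ, permHom_inr]
    obtain ⟨⟨c, d⟩, hcd⟩ : ∃ q, ρ (a, b) = q := ⟨_, rfl⟩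
    -- Level 2 of a vertex lies below a pair only if it is the first vertex of the pair; level 0
    -- does so exactly for both vertices.
    have h0 := fun n => hle n 0 a b
    have h2 := hle a 2 a b
    rw [hcd]
    simp only [hcd, inl_inr] at h0 h2
    have hc : σ a = c := by simpa using h2
    subst hc
    -- Level 0 shows that `{σ a, σ b}` and `{σ a, d}` are the same set, which forces `d = σ b`, also
    -- when `a = b`.
    have hb := h0 b
    have hd := h0 (σ.symm d)
    simp only [Equiv.apply_symm_apply, σ.injective.eq_iff, Equiv.symm_apply_eq] at hb hd
    have : d = σ b := by aesop
    rw [this]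

end GraphLE

theorem smul_poSpace_eq_iff (σ : Equiv.Perm ℕ) (x y : POSpace) :
    σ • x = y ↔ ∀ a b, x.1 a b ↔ y.1 (σ a) (σ b) := by
  constructor
  · rintro rfl a b
    change _ ↔ x.1 (σ⁻¹ (σ a)) (σ⁻¹ (σ b))
    simp
  · intro h
    refine Subtype.ext (funext fun a => funext fun b => propext ?_)
    change x.1 (σ⁻¹ a) (σ⁻¹ b) ↔ _
    rw [h]
    simp

theorem graph_spbReduces_po : SPBReduces (Equiv.Perm ℕ) GraphSpace POSpace := by
  let e : (ℕ × Fin 3) ⊕ (ℕ × ℕ) ≃ ℕ := nonempty_equiv_of_countable.some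
  let f : GraphSpace → POSpace := fun x => ⟨fun m n => GraphLE x.1 (e.symm m) (e.symm n),
    { refl := fun _ => (GraphLE.isPartialOrder x.1).refl _
      trans := fun _ _ _ => (GraphLE.isPartialOrder x.1).trans _ _ _
      antisymm := fun _ _ h k =>
        e.symm.injective ((GraphLE.isPartialOrder x.1).antisymm _ _ h k) }⟩
  have hf : Measurable f := by
    refine Measurable.subtype_mk (measurable_pi_lambda _ fun m => measurable_pi_lambda _ fun n => ?_)
    rcases e.symm m with ⟨c, i⟩ | p <;> rcases e.symm n with ⟨d, j⟩ | ⟨a, b⟩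
    · simp only [GraphLE.inl_inl, measurable_const]
    · refine measurable_of_finite_dependence _ {(a, b)} fun x y h => ?_
      simp only [GraphLE.inl_inr, h (a, b) (Finset.mem_singleton_self _)]
    · simp only [GraphLE.not_inr_inl, measurable_const]
    · simp only [GraphLE.inr_inr, measurable_const]
  refine spbReduces_of_structure e f hf GraphLE.permHom GraphLE.permHom_injective
    (fun x y φ => ∀ p q, GraphLE x.1 p q ↔ GraphLE y.1 (φ p) (φ q)) (fun x y φ => ?_)
    (fun σ x y => (GraphLE.permHom_iff x.2.irrefl y.2.irrefl σ).trans (smul_graphSpace_eq_iff σ x y).symm)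
    fun φ x y h => GraphLE.exists_permHom_eq φ h
  rw [smul_poSpace_eq_iff, e.symm.forall_congr_left]
  refine forall_congr' fun p => ?_
  rw [e.symm.forall_congr_left]
  simp [f]

/-! ### Graphs as semigroups -/

/-- The product of the semigroup of a graph: the product of two vertices is `1` if they are adjacent
and `2` otherwise, and all other products are `0`. -/
noncomputable def graphMul (E : ℕ → ℕ → Prop) : ℕ ⊕ Fin 3 → ℕ ⊕ Fin 3 → ℕ ⊕ Fin 3
  | .inl a, .inl b => open Classical in .inr (if E a b then 1 else 2)
  | _, _ => .inr 0

namespace graphMul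

variable {E E' : ℕ → ℕ → Prop}

theorem inl_inl (a b : ℕ) [Decidable (E a b)] :
    graphMul E (.inl a) (.inl b) = .inr (if E a b then 1 else 2) := by
  simp only [graphMul]
  congr

theorem inr_left (i : Fin 3) (p : ℕ ⊕ Fin 3) : graphMul E (.inr i) p = .inr 0 := by
  rcases p with _ | _ <;> rfl

theorem inr_right (i : Fin 3) (p : ℕ ⊕ Fin 3) : graphMul E p (.inr i) = .inr 0 := by
  rcases p with _ | _ <;> rfl

/-- Every product lies in the right summand, whose elements multiply everything to `0`; so both
triple products are `0`. -/
theorem assoc (p q r : ℕ ⊕ Fin 3) :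
    graphMul E (graphMul E p q) r = graphMul E p (graphMul E q r) := by
  have h : ∀ p q, ∃ i, graphMul E p q = .inr i := by
    rintro (_ | _) (_ | _) <;> exact ⟨_, rfl⟩
  obtain ⟨i, hi⟩ := h p q
  obtain ⟨j, hj⟩ := h q r
  rw [hi, hj, inr_left, inr_right]

/-- The action of the permutations of the vertices on the elements of the semigroup. -/
def permHom : Equiv.Perm ℕ →* Equiv.Perm (ℕ ⊕ Fin 3) where
  toFun σ := σ.sumCongr (Equiv.refl _)
  map_one' := by ext (_ | _) <;> rfl
  map_mul' _ _ := by ext (_ | _) <;> rfl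

theorem permHom_inl (σ : Equiv.Perm ℕ) (a : ℕ) : permHom σ (.inl a) = .inl (σ a) := rfl

theorem permHom_inr (σ : Equiv.Perm ℕ) (i : Fin 3) : permHom σ (.inr i) = .inr i := rfl

theorem permHom_injective : Function.Injective permHom := fun σ τ h => Equiv.ext fun n => by
  simpa [permHom_inl] using DFunLike.congr_fun h (.inl n)

theorem permHom_iff (σ : Equiv.Perm ℕ) :
    (∀ p q, permHom σ (graphMul E p q) = graphMul E' (permHom σ p) (permHom σ q)) ↔
      ∀ a b, E a b ↔ E' (σ a) (σ b) := by
  classical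
  constructor
  · intro h a b
    have := h (.inl a) (.inl b)
    simp only [permHom_inl, permHom_inr, inl_inl, Sum.inr.injEq] at this
    by_cases h1 : E a b <;> by_cases h2 : E' (σ a) (σ b) <;> simp_all
  · rintro h (a | i) (b | j)
    · simp [permHom_inl, permHom_inr, inl_inl, h a b]
    all_goals rfl

theorem exists_permHom_eq (hE : ∀ a, ¬ E a a) (hE' : ∀ a, ¬ E' a a)
    (φ : Equiv.Perm (ℕ ⊕ Fin 3))
    (hφ : ∀ p q, φ (graphMul E p q) = graphMul E' (φ p) (φ q)) : ∃ σ, permHom σ = φ := by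
  classical
  have h0 : φ (.inr 0) = .inr 0 := by
    -- `0` is absorbing on both sides, so `φ 0 = φ (0 · φ⁻¹ 0) = φ 0 · 0 = 0`.
    have := hφ (.inr 0) (φ.symm (.inr 0))
    rwa [inr_left, Equiv.apply_symm_apply, inr_right] at this
  -- By irreflexivity the square of a vertex is `2`, while the other squares are `0`.
  have hrange : ∀ {F : ℕ → ℕ → Prop}, (∀ a, ¬ F a a) → ∀ d,
      d ∈ Set.range Sum.inl ↔ graphMul F d d ≠ .inr 0 := by
    rintro F hF (a | i)
    · simp [inl_inl, hF]
    · simp [inr_left]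
  obtain ⟨σ, hσ⟩ := exists_perm_of_range Sum.inl_injective Sum.inl_injective φ fun d => by
    rw [hrange hE, hrange hE', ← hφ, ← φ.injective.ne_iff, h0]
  have h2 : φ (.inr 2) = .inr 2 := by
    have := hφ (.inl 0) (.inl 0)
    rw [hσ] at this
    simpa [inl_inl, hE, hE'] using this
  -- In a graph without edges `1` is not a product, so it is identified by elimination.
  have h1 : φ (.inr 1) = .inr 1 := by
    rcases h : φ (.inr 1) with a | i
    · have := hσ (σ.symm a)
      rw [Equiv.apply_symm_apply, ← h] at this
      simpa using φ.injective this
    · have hi0 : i ≠ 0 := by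
        rintro rfl
        simpa using φ.injective (h.trans h0.symm)
      have hi2 : i ≠ 2 := by
        rintro rfl
        simpa using φ.injective (h.trans h2.symm)
      have : i = 1 := by omega
      rw [this]
  refine ⟨σ, Equiv.ext ?_⟩
  rintro (a | i)
  · rw [hσ, permHom_inl]
  · rw [permHom_inr]
    fin_cases i
    exacts [h0.symm, h1.symm, h2.symm]

end graphMul

theorem smul_semigroupSpace_eq_iff (σ : Equiv.Perm ℕ) (x y : SemigroupSpace) :
    σ • x = y ↔ ∀ a b, σ (x.1 a b) = y.1 (σ a) (σ b) := by
  constructor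
  · rintro rfl a b
    change _ = σ (x.1 (σ⁻¹ (σ a)) (σ⁻¹ (σ b)))
    simp
  · intro h
    refine Subtype.ext (funext fun a => funext fun b => ?_)
    change σ (x.1 (σ⁻¹ a) (σ⁻¹ b)) = _
    rw [h]
    simp

theorem graph_spbReduces_semigroup : SPBReduces (Equiv.Perm ℕ) GraphSpace SemigroupSpace := by
  classical
  let e : ℕ ⊕ Fin 3 ≃ ℕ := nonempty_equiv_of_countable.some
  let f : GraphSpace → SemigroupSpace := fun x =>
    ⟨fun m n => e (graphMul x.1 (e.symm m) (e.symm n)), ⟨by simp [graphMul.assoc]⟩⟩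
  have hf : Measurable f := by
    refine Measurable.subtype_mk (measurable_pi_lambda _ fun m => measurable_pi_lambda _ fun n => ?_)
    rcases e.symm m with a | i
    · rcases e.symm n with b | j
      · refine measurable_of_finite_dependence _ {(a, b)} fun x y h => ?_
        simp only [graphMul.inl_inl, h (a, b) (Finset.mem_singleton_self _)]
      · simp only [graphMul.inr_right, measurable_const]
    · simp only [graphMul.inr_left, measurable_const]
  refine spbReduces_of_structure e f hf graphMul.permHom graphMul.permHom_injective
    (fun x y φ => ∀ p q, φ (graphMul x.1 p q) = graphMul y.1 (φ p) (φ q)) (fun x y φ => ?_)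
    (fun σ x y => (graphMul.permHom_iff σ).trans (smul_graphSpace_eq_iff σ x y).symm)
    fun φ x y h => graphMul.exists_permHom_eq x.2.irrefl y.2.irrefl φ h
  rw [smul_semigroupSpace_eq_iff, e.symm.forall_congr_left]
  refine forall_congr' fun p => ?_
  rw [e.symm.forall_congr_left]
  simp [f]

/-! ### Graphs as rings -/

/-- The weight of an ordered pair of vertices of a graph. -/
noncomputable def pairWeight (E : ℕ → ℕ → Prop) (p : ℕ × ℕ) : ℤ :=
  open Classical in if E p.1 p.2 then 2 else 3

/-- The linear map sending the pair `(a, b)` to `a + k b`, where `k` is its weight. -/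
noncomputable def pairMap (E : ℕ → ℕ → Prop) : (ℕ × ℕ →₀ ℤ) →ₗ[ℤ] (ℕ →₀ ℤ) :=
  Finsupp.linearCombination ℤ fun p => Finsupp.single p.1 1 + Finsupp.single p.2 (pairWeight E p)

theorem pairMap_single_apply (E : ℕ → ℕ → Prop) (a b v : ℕ) :
    pairMap E (Finsupp.single (a, b) 1) v =
      (if a = v then 1 else 0) + if b = v then pairWeight E (a, b) else 0 := by
  simp [pairMap, Finsupp.single_apply]

/-- Serves Borel measurability: `T u` depends only on the edges among the finitely many pairs in the
support of `u`. -/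
theorem pairMap_congr {E E' : ℕ → ℕ → Prop} {u : ℕ × ℕ →₀ ℤ}
    (h : ∀ p ∈ u.support, E p.1 p.2 ↔ E' p.1 p.2) : pairMap E u = pairMap E' u := by
  simp only [pairMap, Finsupp.linearCombination_apply]
  refine Finsupp.sum_congr fun p hp => ?_
  have hw : pairWeight E p = pairWeight E' p := by
    unfold pairWeight
    rw [propext (h p hp)]
  rw [hw]

theorem pairWeight_eq_or (E : ℕ → ℕ → Prop) (p : ℕ × ℕ) :
    pairWeight E p = 2 ∨ pairWeight E p = 3 := by
  unfold pairWeight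
  split_ifs <;> simp

theorem pairWeight_eq_two_iff {E : ℕ → ℕ → Prop} {p : ℕ × ℕ} :
    pairWeight E p = 2 ↔ E p.1 p.2 := by
  unfold pairWeight
  split_ifs <;> simp_all

theorem pairMap_equivMapDomain {E E' : ℕ → ℕ → Prop} {σ : Equiv.Perm ℕ}
    (h : ∀ a b, E a b ↔ E' (σ a) (σ b)) (u : ℕ × ℕ →₀ ℤ) (a : ℕ) :
    pairMap E' (u.equivMapDomain (σ.prodCongr σ)) (σ a) = pairMap E u a := by
  rw [pairMap, Finsupp.linearCombination_equivMapDomain, pairMap]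
  induction u using Finsupp.induction_linear with
  | zero => simp
  | add u v hu hv => simp only [map_add, Finsupp.add_apply, hu, hv]
  | single p n =>
    have hw : pairWeight E' (σ p.1, σ p.2) = pairWeight E p := by
      unfold pairWeight
      rw [← propext (h p.1 p.2)]
    simp [Finsupp.single_apply, Prod.map, hw]

/-- The domain of the rings of graphs. -/
abbrev RingDomain : Type := ℤ × (ℕ × ℕ →₀ ℤ) × (ℕ →₀ ℤ)

/-- The ring of a graph. The triple `(c, u, w)` represents the function on pairs of vertices and on
vertices whose value is `c + 10 u p` at the pair `p` and `c + 10 T u a + 25 w a` at the vertex `a`,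
where `T = pairMap E`. Addition and multiplication are pointwise. -/
def GraphRing (_ : ℕ → ℕ → Prop) : Type := RingDomain

namespace GraphRing

variable {E E' : ℕ → ℕ → Prop}

/-! ### The ring structure on triples -/

noncomputable instance : AddCommGroup (GraphRing E) := inferInstanceAs (AddCommGroup RingDomain)

noncomputable instance : One (GraphRing E) := ⟨((1, 0, 0) : RingDomain)⟩

/-- The product of two triples. -/
noncomputable def mulFun (E : ℕ → ℕ → Prop) (q r : RingDomain) : RingDomain :=
  (q.1 * r.1, q.1 • r.2.1 + r.1 • q.2.1 + (10 : ℤ) • (q.2.1 * r.2.1),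
    q.1 • r.2.2 + r.1 • q.2.2 +
      (((2 : ℤ) • pairMap E q.2.1 + (5 : ℤ) • q.2.2) * ((2 : ℤ) • pairMap E r.2.1 + (5 : ℤ) • r.2.2)
        - (4 : ℤ) • pairMap E (q.2.1 * r.2.1)))

noncomputable instance : Mul (GraphRing E) := ⟨mulFun E⟩

/-- The value at infinity. -/
def constFun (q : RingDomain) : ℤ := q.1

/-- The value at a pair. -/
def pairFun (p : ℕ × ℕ) (q : RingDomain) : ℤ := q.1 + 10 * q.2.1 p

/-- The value at a vertex. -/
noncomputable def vertFun (E : ℕ → ℕ → Prop) (a : ℕ) (q : RingDomain) : ℤ :=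
  q.1 + 10 * pairMap E q.2.1 a + 25 * q.2.2 a

/-- The values determine `c`, then `u`, then `w`. Once the operations are known to be pointwise, the
ring axioms are therefore inherited from `ℤ`. -/
theorem ext_vals {q r : GraphRing E} (hc : constFun q = constFun r)
    (hp : ∀ p, pairFun p q = pairFun p r) (hv : ∀ a, vertFun E a q = vertFun E a r) : q = r := by
  obtain ⟨c, u, w⟩ := q
  obtain ⟨c', u', w'⟩ := r
  obtain rfl : c = c' := hc
  obtain rfl : u = u' := by
    ext p
    simpa [pairFun] using hp p
  obtain rfl : w = w' := by
    ext a
    simpa [vertFun] using hv a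
  rfl

theorem constFun_add (q r : GraphRing E) : constFun (q + r : GraphRing E) = constFun q + constFun r :=
  rfl

theorem pairFun_add (p : ℕ × ℕ) (q r : GraphRing E) :
    pairFun p (q + r : GraphRing E) = pairFun p q + pairFun p r := by
  change (q.1 + r.1) + 10 * (q.2.1 p + r.2.1 p) = (q.1 + _) + (r.1 + _)
  ring

theorem vertFun_add (a : ℕ) (q r : GraphRing E) :
    vertFun E a (q + r : GraphRing E) = vertFun E a q + vertFun E a r := by
  change (q.1 + r.1) + 10 * pairMap E (q.2.1 + r.2.1) a + 25 * (q.2.2 a + r.2.2 a) =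
    (q.1 + _ + _) + (r.1 + _ + _)
  rw [map_add, Finsupp.add_apply]
  ring

theorem constFun_mul (q r : GraphRing E) : constFun (q * r : GraphRing E) = constFun q * constFun r :=
  rfl

theorem pairFun_mul (p : ℕ × ℕ) (q r : GraphRing E) :
    pairFun p (q * r : GraphRing E) = pairFun p q * pairFun p r := by
  change pairFun p (mulFun E q r) = _
  simp only [pairFun, mulFun, Finsupp.add_apply, Finsupp.smul_apply, Finsupp.mul_apply, smul_eq_mul]
  ring

/-- This identity dictates the last component in `mulFun`: it is the part of the product at `a` left
over by the first two components, divided by 25. The division is possible because 25 divides `10 ·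
10`. -/
theorem vertFun_mul (a : ℕ) (q r : GraphRing E) :
    vertFun E a (q * r : GraphRing E) = vertFun E a q * vertFun E a r := by
  change vertFun E a (mulFun E q r) = _
  simp only [vertFun, mulFun, Finsupp.add_apply, Finsupp.sub_apply, Finsupp.smul_apply,
    Finsupp.mul_apply, smul_eq_mul, map_add, map_smul]
  ring

theorem constFun_one : constFun (1 : GraphRing E) = 1 := rfl

theorem pairFun_one (p : ℕ × ℕ) : pairFun p (1 : GraphRing E) = 1 := rfl

theorem vertFun_one (a : ℕ) : vertFun E a (1 : GraphRing E) = 1 := by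
  change 1 + 10 * pairMap E 0 a + 25 * 0 = (1 : ℤ)
  simp

noncomputable instance : CommRing (GraphRing E) :=
  have h0 : ∀ a, vertFun E a (0 : GraphRing E) = 0 := fun a => by
    simpa using vertFun_add a (0 : GraphRing E) 0
  have h0' : ∀ p, pairFun p (0 : GraphRing E) = 0 := fun p => by
    simpa using pairFun_add p (0 : GraphRing E) 0
  have h0'' : constFun (0 : GraphRing E) = 0 := rfl
  { (inferInstance : AddCommGroup (GraphRing E)),
    (inferInstance : One (GraphRing E)), (inferInstance : Mul (GraphRing E)) with
    mul_assoc := fun q r s => by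
      apply ext_vals <;> intros <;> simp only [constFun_mul, pairFun_mul, vertFun_mul, mul_assoc]
    mul_comm := fun q r => by
      apply ext_vals <;> intros <;> simp only [constFun_mul, pairFun_mul, vertFun_mul, mul_comm]
    one_mul := fun q => by
      apply ext_vals <;> intros <;> simp only [constFun_mul, pairFun_mul, vertFun_mul,
        constFun_one, pairFun_one, vertFun_one, one_mul]
    mul_one := fun q => by
      apply ext_vals <;> intros <;> simp only [constFun_mul, pairFun_mul, vertFun_mul,
        constFun_one, pairFun_one, vertFun_one, mul_one]
    zero_mul := fun q => by
      apply ext_vals <;> intros <;> simp only [constFun_mul, pairFun_mul, vertFun_mul,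
        h0, h0', h0'', zero_mul]
    mul_zero := fun q => by
      apply ext_vals <;> intros <;> simp only [constFun_mul, pairFun_mul, vertFun_mul,
        h0, h0', h0'', mul_zero]
    left_distrib := fun q r s => by
      apply ext_vals <;> intros <;> simp only [constFun_mul, pairFun_mul, vertFun_mul,
        constFun_add, pairFun_add, vertFun_add, mul_add]
    right_distrib := fun q r s => by
      apply ext_vals <;> intros <;> simp only [constFun_mul, pairFun_mul, vertFun_mul,
        constFun_add, pairFun_add, vertFun_add, add_mul] }

/-- The value at infinity, as a ring homomorphism. -/
noncomputable def const : GraphRing E →+* ℤ :=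
  RingHom.mk' ⟨⟨constFun, constFun_one⟩, constFun_mul⟩ constFun_add

/-- The value at a pair, as a ring homomorphism. -/
noncomputable def pairVal (p : ℕ × ℕ) : GraphRing E →+* ℤ :=
  RingHom.mk' ⟨⟨pairFun p, pairFun_one p⟩, pairFun_mul p⟩ (pairFun_add p)

/-- The value at a vertex, as a ring homomorphism. -/
noncomputable def vertVal (a : ℕ) : GraphRing E →+* ℤ :=
  RingHom.mk' ⟨⟨vertFun E a, vertFun_one a⟩, vertFun_mul a⟩ (vertFun_add a)

theorem ext {q r : GraphRing E} (hc : const q = const r) (hp : ∀ p, pairVal p q = pairVal p r)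
    (hv : ∀ a, vertVal a q = vertVal a r) : q = r := ext_vals hc hp hv

/-- The element of the ring represented by a triple. -/
def mk (E : ℕ → ℕ → Prop) (c : ℤ) (u : ℕ × ℕ →₀ ℤ) (w : ℕ →₀ ℤ) : GraphRing E := (c, u, w)

theorem exists_mk (q : GraphRing E) : ∃ c u w, q = mk E c u w := ⟨_, _, _, rfl⟩

theorem const_mk (c u w) : const (mk E c u w) = c := rfl

theorem pairVal_mk (p c u w) : pairVal p (mk E c u w) = c + 10 * u p := rfl

theorem vertVal_mk (a c u w) : vertVal a (mk E c u w) = c + 10 * pairMap E u a + 25 * w a := rfl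

/-- The element with value `25` at the vertex `a` and `0` elsewhere. -/
noncomputable def vertAtom (E : ℕ → ℕ → Prop) (a : ℕ) : GraphRing E := mk E 0 0 (Finsupp.single a 1)

/-- The element with value `50` at the pair `p` and `0` elsewhere. -/
noncomputable def pairAtom (E : ℕ → ℕ → Prop) (p : ℕ × ℕ) : GraphRing E :=
  mk E 0 ((5 : ℤ) • Finsupp.single p 1) ((-2 : ℤ) • pairMap E (Finsupp.single p 1))

/-! ### Atoms and their algebraic description -/

theorem const_vertAtom (a : ℕ) : const (vertAtom E a) = 0 := rfl

theorem pairVal_vertAtom (p : ℕ × ℕ) (a : ℕ) : pairVal p (vertAtom E a) = 0 := rfl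

theorem vertVal_vertAtom (a b : ℕ) : vertVal b (vertAtom E a) = if a = b then 25 else 0 := by
  simp [vertAtom, vertVal_mk, Finsupp.single_apply]

theorem const_pairAtom (p : ℕ × ℕ) : const (pairAtom E p) = 0 := rfl

theorem pairVal_pairAtom (p r : ℕ × ℕ) : pairVal r (pairAtom E p) = if p = r then 50 else 0 := by
  simp [pairAtom, pairVal_mk, Finsupp.single_apply]

/-- The coefficients 5 and -2 cancel here: `10 · 5 = 25 · 2`. This is why the atom at a pair has
value 50 and not 10. -/
theorem vertVal_pairAtom (p : ℕ × ℕ) (a : ℕ) : vertVal a (pairAtom E p) = 0 := by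
  simp only [pairAtom, vertVal_mk, map_smul, Finsupp.smul_apply, smul_eq_mul]
  ring

/-- Values become algebraic: `q` acts on the atom at `a` as the integer `vertVal a q`, so an
isomorphism that permutes the atoms carries values along. -/
theorem mul_vertAtom (q : GraphRing E) (a : ℕ) :
    q * vertAtom E a = (vertVal a q : GraphRing E) * vertAtom E a := by
  refine ext ?_ (fun p => ?_) fun b => ?_
  · simp [const_vertAtom]
  · simp [pairVal_vertAtom]
  · rcases eq_or_ne a b with rfl | h
    · simp
    · simp [vertVal_vertAtom, h]

theorem mul_pairAtom (q : GraphRing E) (p : ℕ × ℕ) :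
    q * pairAtom E p = (pairVal p q : GraphRing E) * pairAtom E p := by
  refine ext ?_ (fun r => ?_) fun b => ?_
  · simp [const_pairAtom]
  · rcases eq_or_ne p r with rfl | h
    · simp
    · simp [pairVal_pairAtom, h]
  · simp [vertVal_pairAtom]

theorem vertAtom_injective : Function.Injective (vertAtom E) := fun a b h => by
  by_contra hab
  simpa [vertVal_vertAtom, hab] using congrArg (vertVal b) h

theorem pairAtom_injective : Function.Injective (pairAtom E) := fun p r h => by
  by_contra hpr
  simpa [pairVal_pairAtom, hpr] using congrArg (pairVal r) h

/-- A nonzero solution of `q² = n q` that is minimal among these solutions. -/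
def IsScaledAtom {R : Type*} [CommRing R] (n : ℤ) (q : R) : Prop :=
  q ≠ 0 ∧ q * q = n * q ∧ ∀ r : R, r * r = n * r → q * r = 0 ∨ q * r = n * q

theorem IsScaledAtom.map {R S : Type*} [CommRing R] [CommRing S] {n : ℤ} {q : R}
    (h : IsScaledAtom n q) (ψ : R ≃+* S) : IsScaledAtom n (ψ q) := by
  refine ⟨by simpa using h.1, by rw [← map_mul, h.2.1]; simp, fun r hr => ?_⟩
  obtain ⟨r, rfl⟩ := ψ.surjective r
  have hr' : r * r = n * r := ψ.injective (by simpa using hr)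
  refine (h.2.2 r hr').imp (fun h => ?_) fun h => ?_
  · rw [← map_mul, h, map_zero]
  · rw [← map_mul, h]
    simp

theorem isScaledAtom_map_iff {R S : Type*} [CommRing R] [CommRing S] {n : ℤ} {q : R}
    (ψ : R ≃+* S) : IsScaledAtom n (ψ q) ↔ IsScaledAtom n q :=
  ⟨fun h => by simpa using h.map ψ.symm, fun h => h.map ψ⟩

/-- No atom sits at infinity; the value there is recovered as the value at almost every vertex. -/
theorem exists_vertVal_eq_const (q : GraphRing E) : ∃ s : Finset ℕ, ∀ a ∉ s, vertVal a q = const q := by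
  obtain ⟨c, u, w, rfl⟩ := exists_mk q
  refine ⟨(pairMap E u).support ∪ w.support, fun a ha => ?_⟩
  simp only [Finset.mem_union, Finsupp.mem_support_iff, not_or, not_not] at ha
  simp [vertVal_mk, const_mk, ha]

theorem intCast_mul_cancel {n : ℤ} (hn : n ≠ 0) {q r : GraphRing E}
    (h : (n : GraphRing E) * q = n * r) : q = r := by
  refine ext ?_ (fun p => ?_) fun a => ?_
  · simpa [hn] using congrArg const h
  · simpa [hn] using congrArg (pairVal p) h
  · simpa [hn] using congrArg (vertVal a) h

/-- Solutions of `q² = 25 q` take only the values 0 and 25. A nonzero one cannot vanish at all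
vertices, and minimality leaves a single vertex in its support. -/
theorem mem_range_vertAtom_iff (q : GraphRing E) :
    q ∈ Set.range (vertAtom E) ↔ IsScaledAtom 25 q := by
  have hval : ∀ {r : GraphRing E} (f : GraphRing E →+* ℤ), r * r = (25 : ℤ) * r →
      f r = 0 ∨ f r = 25 := fun {r} f hr => by
    have h := congrArg f hr
    simp only [map_mul, map_intCast, Int.cast_id] at h
    have : f r * (f r - 25) = 0 := by linarith
    rcases mul_eq_zero.1 this with h | h
    exacts [.inl h, .inr (by omega)]
  have hatom : ∀ a, vertAtom E a * vertAtom E a = (25 : ℤ) * vertAtom E a := fun a => by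
    rw [mul_vertAtom, vertVal_vertAtom, if_pos rfl]
  constructor
  · rintro ⟨a, rfl⟩
    refine ⟨fun h => ?_, hatom a, fun r hr => ?_⟩
    · simpa [vertVal_vertAtom] using congrArg (vertVal a) h
    · rw [mul_comm, mul_vertAtom]
      rcases hval (vertVal a) hr with h | h <;> rw [h]
      · left
        simp
      · exact .inr rfl
  · rintro ⟨h0, hq, hmin⟩
    obtain ⟨a, ha⟩ : ∃ a, vertVal a q ≠ 0 := by
      by_contra! hv
      obtain ⟨s, hs⟩ := exists_vertVal_eq_const q
      obtain ⟨b, hb⟩ := Infinite.exists_notMem_finset s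
      have hc : const q = 0 := by rw [← hs b hb, hv]
      refine h0 (ext (by simpa using hc) (fun p => ?_) fun a => by simpa using hv a)
      -- Once the constant is 0, values at pairs are multiples of 10, which rules out 25.
      have hp := hval (pairVal p) hq
      obtain ⟨c, u, w, rfl⟩ := exists_mk q
      rw [const_mk] at hc
      rw [pairVal_mk] at hp ⊢
      rw [map_zero]
      omega
    refine ⟨a, intCast_mul_cancel (n := 25) (by norm_num) ?_⟩
    have h25 : vertVal a q = 25 := (hval _ hq).resolve_left ha
    -- Minimality is tested against the atom at `a`: `q` times it is 25 times it, which is not 0 and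
    -- hence equals `25 q`.
    have hm := hmin _ (hatom a)
    rw [mul_vertAtom, h25] at hm
    refine hm.resolve_left fun h => ?_
    have h' := congrArg (vertVal a) h
    rw [map_mul, map_intCast, vertVal_vertAtom, if_pos rfl, map_zero] at h'
    norm_num at h'

/-- Annihilation of the vertex atoms is needed because twice a vertex atom is also a minimal
solution of `q² = 50 q`. It makes `q` vanish at all vertices, hence at infinity, so a nonzero `q`
lives on pairs. -/
theorem mem_range_pairAtom_iff (q : GraphRing E) :
    q ∈ Set.range (pairAtom E) ↔ IsScaledAtom 50 q ∧ ∀ a, q * vertAtom E a = 0 := by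
  have hval : ∀ {r : GraphRing E} (f : GraphRing E →+* ℤ), r * r = (50 : ℤ) * r →
      f r = 0 ∨ f r = 50 := fun {r} f hr => by
    have h := congrArg f hr
    simp only [map_mul, map_intCast, Int.cast_id] at h
    have : f r * (f r - 50) = 0 := by linarith
    rcases mul_eq_zero.1 this with h | h
    exacts [.inl h, .inr (by omega)]
  have hatom : ∀ p, pairAtom E p * pairAtom E p = (50 : ℤ) * pairAtom E p := fun p => by
    rw [mul_pairAtom, pairVal_pairAtom, if_pos rfl]
  constructor
  · rintro ⟨p, rfl⟩
    refine ⟨⟨fun h => ?_, hatom p, fun r hr => ?_⟩, fun a => ?_⟩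
    · simpa [pairVal_pairAtom] using congrArg (pairVal p) h
    · rw [mul_comm, mul_pairAtom]
      rcases hval (pairVal p) hr with h | h <;> rw [h]
      · left
        simp
      · exact .inr rfl
    · rw [mul_vertAtom, vertVal_pairAtom]
      simp
  · rintro ⟨⟨h0, hq, hmin⟩, hzero⟩
    have hv : ∀ a, vertVal a q = 0 := fun a => by
      simpa [vertVal_vertAtom] using congrArg (vertVal a) (hzero a)
    obtain ⟨p, hp⟩ : ∃ p, pairVal p q ≠ 0 := by
      by_contra! hp
      obtain ⟨s, hs⟩ := exists_vertVal_eq_const q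
      obtain ⟨b, hb⟩ := Infinite.exists_notMem_finset s
      have hc : const q = 0 := by rw [← hs b hb, hv]
      exact h0 (ext (by simpa using hc) (by simpa using hp) (by simpa using hv))
    refine ⟨p, intCast_mul_cancel (n := 50) (by norm_num) ?_⟩
    have h50 : pairVal p q = 50 := (hval _ hq).resolve_left hp
    have hm := hmin _ (hatom p)
    rw [mul_pairAtom, h50] at hm
    refine hm.resolve_left fun h => ?_
    have h' := congrArg (pairVal p) h
    rw [map_mul, map_intCast, pairVal_pairAtom, if_pos rfl, map_zero] at h'
    norm_num at h'

/-- The action of the permutations of the vertices on the domain of the rings. -/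
noncomputable def permHom : Equiv.Perm ℕ →* Equiv.Perm RingDomain where
  toFun σ :=
    { toFun := fun q => (q.1, q.2.1.equivMapDomain (σ.prodCongr σ), q.2.2.equivMapDomain σ)
      invFun := fun q =>
        (q.1, q.2.1.equivMapDomain (σ.prodCongr σ).symm, q.2.2.equivMapDomain σ.symm)
      left_inv := fun q => Prod.ext rfl (Prod.ext
        (Finsupp.ext fun p => congrArg q.2.1 ((σ.prodCongr σ).symm_apply_apply p))
        (Finsupp.ext fun a => by simp))
      right_inv := fun q => Prod.ext rfl (Prod.ext
        (Finsupp.ext fun p => congrArg q.2.1 ((σ.prodCongr σ).apply_symm_apply p))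
        (Finsupp.ext fun a => by simp)) }
  map_one' := Equiv.ext fun q => Prod.ext rfl (Prod.ext (Finsupp.ext fun _ => rfl)
    (Finsupp.ext fun _ => rfl))
  map_mul' _ _ := Equiv.ext fun q => Prod.ext rfl (Prod.ext (Finsupp.ext fun _ => rfl)
    (Finsupp.ext fun _ => rfl))

/-- The isomorphism of rings induced by an isomorphism of graphs. -/
noncomputable def permEquiv (σ : Equiv.Perm ℕ) (h : ∀ a b, E a b ↔ E' (σ a) (σ b)) :
    GraphRing E ≃+* GraphRing E' :=
  have hp : ∀ (p : ℕ × ℕ) (q : GraphRing E),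
      pairFun (σ.prodCongr σ p) (permHom σ q) = pairFun p q := fun p q => by
    simp only [pairFun, permHom, MonoidHom.coe_mk, OneHom.coe_mk, Equiv.coe_fn_mk,
      Finsupp.equivMapDomain_apply, Equiv.symm_apply_apply]
  have hv : ∀ (a : ℕ) (q : GraphRing E), vertFun E' (σ a) (permHom σ q) = vertFun E a q :=
    fun a q => by
      simp [vertFun, permHom, pairMap_equivMapDomain h]
  { permHom σ with
    map_add' := fun q r => by
      refine ext_vals rfl (fun p => ?_) fun a => ?_
      · obtain ⟨p, rfl⟩ := (σ.prodCongr σ).surjective p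
        exact (hp p _).trans ((pairFun_add p q r).trans
          ((congrArg₂ _ (hp p q).symm (hp p r).symm).trans (pairFun_add (E := E') _ _ _).symm))
      · obtain ⟨a, rfl⟩ := σ.surjective a
        exact (hv a _).trans ((vertFun_add a q r).trans
          ((congrArg₂ _ (hv a q).symm (hv a r).symm).trans (vertFun_add _ _ _).symm))
    map_mul' := fun q r => by
      refine ext_vals rfl (fun p => ?_) fun a => ?_
      · obtain ⟨p, rfl⟩ := (σ.prodCongr σ).surjective p
        exact (hp p _).trans ((pairFun_mul p q r).trans
          ((congrArg₂ _ (hp p q).symm (hp p r).symm).trans (pairFun_mul (E := E') _ _ _).symm))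
      · obtain ⟨a, rfl⟩ := σ.surjective a
        exact (hv a _).trans ((vertFun_mul a q r).trans
          ((congrArg₂ _ (hv a q).symm (hv a r).symm).trans (vertFun_mul _ _ _).symm)) }

theorem pairVal_permEquiv (σ : Equiv.Perm ℕ) (h : ∀ a b, E a b ↔ E' (σ a) (σ b))
    (q : GraphRing E) (a b : ℕ) : pairVal (σ a, σ b) (permEquiv σ h q) = pairVal (a, b) q := by
  change pairFun (σ a, σ b) (permHom σ q) = pairFun (a, b) q
  simp [pairFun, permHom]

theorem vertVal_permEquiv (σ : Equiv.Perm ℕ) (h : ∀ a b, E a b ↔ E' (σ a) (σ b))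
    (q : GraphRing E) (a : ℕ) : vertVal (σ a) (permEquiv σ h q) = vertVal a q := by
  change vertFun E' (σ a) (permHom σ q) = vertFun E a q
  simp [vertFun, permHom, pairMap_equivMapDomain h]

/-! ### Faithfulness and fullness of the ring construction -/

theorem permHom_injective : Function.Injective permHom := fun σ τ h => Equiv.ext fun n => by
  have h1 : (permHom σ (0, 0, Finsupp.single n 1)).2.2 = (permHom τ (0, 0, Finsupp.single n 1)).2.2 :=
    by rw [h]
  simpa [permHom, Finsupp.equivMapDomain_single, Finsupp.single_left_inj] using h1

/-- The weights differ from the coefficient 1 of the first vertex, so `1_a + k 1_b` shows which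
vertex comes first. If `a = b`, the support is a single point with value `1 + k`. -/
theorem eq_of_weights {a b c d : ℕ} {k l : ℤ} (hk : k = 2 ∨ k = 3) (hl : l = 2 ∨ l = 3)
    (h : ∀ v : ℕ, ((if a = v then 1 else 0) + if b = v then k else 0 : ℤ) =
      (if c = v then 1 else 0) + if d = v then l else 0) : a = c ∧ b = d ∧ k = l := by
  have ha := h a
  have hc := h c
  obtain rfl : a = c := by
    by_contra hne
    simp only [if_true, hne, Ne.symm hne, if_false] at ha hc
    split_ifs at ha hc <;> omega
  have hb := h b
  simp only [add_right_inj, if_true] at hb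
  split_ifs at hb with hdb
  · exact ⟨rfl, hdb.symm, hb⟩
  · omega

/-- The algebraic descriptions of the atoms yield permutations `σ` of vertices and `ρ` of pairs
along which `ψ` preserves values. It remains to see that `ρ` is induced by `σ` and that `σ`
preserves adjacency. -/
theorem exists_perm (ψ : GraphRing E ≃+* GraphRing E') :
    ∃ (σ : Equiv.Perm ℕ) (h : ∀ a b, E a b ↔ E' (σ a) (σ b)), ψ = permEquiv σ h := by
  obtain ⟨σ, hσ⟩ := exists_perm_of_range vertAtom_injective vertAtom_injective ψ.toEquiv
    fun q => by
      rw [mem_range_vertAtom_iff, mem_range_vertAtom_iff]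
      exact (isScaledAtom_map_iff ψ).symm
  replace hσ : ∀ a, ψ (vertAtom E a) = vertAtom E' (σ a) := hσ
  obtain ⟨ρ, hρ⟩ := exists_perm_of_range pairAtom_injective pairAtom_injective ψ.toEquiv
    fun q => by
      rw [mem_range_pairAtom_iff, mem_range_pairAtom_iff]
      refine and_congr (isScaledAtom_map_iff ψ).symm (σ.forall_congr fun a => ?_)
      rw [← hσ]
      change _ ↔ ψ q * _ = 0
      rw [← map_mul, map_eq_zero_iff ψ ψ.injective]
  replace hρ : ∀ p, ψ (pairAtom E p) = pairAtom E' (ρ p) := hρ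
  have hvert : ∀ q a, vertVal (σ a) (ψ q) = vertVal a q := fun q a => by
    have h := congrArg (vertVal (σ a)) (congrArg ψ (mul_vertAtom q a))
    simpa [hσ, vertVal_vertAtom] using h
  have hpair : ∀ q p, pairVal (ρ p) (ψ q) = pairVal p q := fun q p => by
    have h := congrArg (pairVal (ρ p)) (congrArg ψ (mul_pairAtom q p))
    simpa [hρ, pairVal_pairAtom] using h
  have hconst : ∀ q, const (ψ q) = const q := fun q => by
    obtain ⟨s, hs⟩ := exists_vertVal_eq_const q
    obtain ⟨t, ht⟩ := exists_vertVal_eq_const (ψ q)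
    -- A vertex is chosen at which `q`, and at whose image `ψ q`, already takes its value at
    -- infinity.
    obtain ⟨a, ha⟩ := Infinite.exists_notMem_finset (s ∪ t.map σ.symm.toEmbedding)
    simp only [Finset.mem_union, Finset.mem_map_equiv, Equiv.symm_symm, not_or] at ha
    rw [← ht _ ha.2, hvert, hs _ ha.1]
  have hpairs : ∀ a b, ρ (a, b) = (σ a, σ b) ∧ (E a b ↔ E' (σ a) (σ b)) := fun a b => by
    -- The test element has value 10 at `(a, b)` and 0 at the other pairs and at infinity. Its image
    -- is of the same kind at `ρ (a, b)`, up to an unknown `w`.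
    obtain ⟨c, u, w, hq⟩ := exists_mk (ψ (mk E 0 (Finsupp.single (a, b) 1) 0))
    obtain rfl : c = 0 := by
      rw [← const_mk (E := E') c u w, ← hq, hconst, const_mk]
    obtain rfl : u = Finsupp.single (ρ (a, b)) 1 := by
      ext p
      obtain ⟨p, rfl⟩ := ρ.surjective p
      have h := hpair (mk E 0 (Finsupp.single (a, b) 1) 0) p
      rw [hq, pairVal_mk, pairVal_mk] at h
      rw [Finsupp.single_apply] at h ⊢
      simp only [ρ.injective.eq_iff]
      omega
    obtain ⟨⟨c, d⟩, hcd⟩ : ∃ p, ρ (a, b) = p := ⟨_, rfl⟩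
    rw [hcd] at hq ⊢
    have h := eq_of_weights (pairWeight_eq_or E (a, b)) (pairWeight_eq_or E' (c, d))
      (a := a) (b := b) (c := σ.symm c) (d := σ.symm d) fun v => by
        have h := hvert (mk E 0 (Finsupp.single (a, b) 1) 0) v
        rw [hq, vertVal_mk, vertVal_mk, pairMap_single_apply, pairMap_single_apply,
          Finsupp.zero_apply] at h
        simp only [Equiv.symm_apply_eq]
        have h1 := pairWeight_eq_or E (a, b)
        have h2 := pairWeight_eq_or E' (c, d)
        -- Because of `w`, the equality `h` only gives `10 x ≡ 10 y` modulo 25, that is `x ≡ y`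
        -- modulo 5. Both sides lie between 0 and 4, the largest case being `1 + 3`, so they are
        -- equal.
        split_ifs at h ⊢ <;> omega
    obtain ⟨rfl, rfl, hk⟩ := h
    simp only [Equiv.apply_symm_apply, true_and]
    exact (pairWeight_eq_two_iff (p := (σ.symm c, σ.symm d))).symm.trans
      (hk ▸ pairWeight_eq_two_iff (p := (c, d)))
  refine ⟨σ, fun a b => (hpairs a b).2, RingEquiv.ext fun q => ext (hconst q) (fun p => ?_)
    fun a => ?_⟩
  · obtain ⟨⟨a, b⟩, rfl⟩ := (σ.prodCongr σ).surjective p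
    change pairVal (σ a, σ b) _ = pairVal (σ a, σ b) _
    rw [pairVal_permEquiv, ← (hpairs a b).1, hpair]
  · obtain ⟨a, rfl⟩ := σ.surjective a
    rw [vertVal_permEquiv, hvert]

end GraphRing

/-! ### Transfer of countable rings to `ℕ` -/

theorem smul_ringSpace_eq_iff (σ : Equiv.Perm ℕ) (x y : RingSpace) :
    σ • x = y ↔ (∀ a b, σ (x.1.add a b) = y.1.add (σ a) (σ b)) ∧
        (∀ a b, σ (x.1.mul a b) = y.1.mul (σ a) (σ b)) ∧
        (∀ a, σ (x.1.neg a) = y.1.neg (σ a)) ∧ σ x.1.zero = y.1.zero ∧ σ x.1.one = y.1.one := by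
  constructor
  · rintro rfl
    refine ⟨fun a b => ?_, fun a b => ?_, fun a => ?_, rfl, rfl⟩
    · change _ = σ (x.1.add (σ⁻¹ (σ a)) (σ⁻¹ (σ b)))
      simp
    · change _ = σ (x.1.mul (σ⁻¹ (σ a)) (σ⁻¹ (σ b)))
      simp
    · change _ = σ (x.1.neg (σ⁻¹ (σ a)))
      simp
  · rintro ⟨hadd, hmul, hneg, hzero, hone⟩
    refine Subtype.ext (Prod.ext ?_ (Prod.ext ?_ (Prod.ext ?_ (Prod.ext hzero hone))))
    · funext a b
      change σ (x.1.add (σ⁻¹ a) (σ⁻¹ b)) = y.1.add a b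
      rw [hadd]
      simp
    · funext a b
      change σ (x.1.mul (σ⁻¹ a) (σ⁻¹ b)) = y.1.mul a b
      rw [hmul]
      simp
    · funext a
      change σ (x.1.neg (σ⁻¹ a)) = y.1.neg a
      rw [hneg]
      simp

/-- The code on `ℕ` of a countable ring. -/
def ringCode {R : Type*} [Ring R] (e : R ≃ ℕ) : RingCode :=
  (fun m n => e (e.symm m + e.symm n), fun m n => e (e.symm m * e.symm n), fun m => e (-e.symm m),
    e 0, e 1)

theorem isUnitalRing_ringCode {R : Type*} [Ring R] (e : R ≃ ℕ) : IsUnitalRing (ringCode e) where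
  add_assoc _ _ _ := by simp [ringCode, RingCode.add, add_assoc]
  add_comm _ _ := by simp [ringCode, RingCode.add, add_comm]
  zero_add _ := by simp [ringCode, RingCode.add, RingCode.zero]
  neg_add_cancel _ := by simp [ringCode, RingCode.add, RingCode.neg, RingCode.zero]
  mul_assoc _ _ _ := by simp [ringCode, RingCode.mul, mul_assoc]
  one_mul _ := by simp [ringCode, RingCode.mul, RingCode.one]
  mul_one _ := by simp [ringCode, RingCode.mul, RingCode.one]
  left_distrib _ _ _ := by simp [ringCode, RingCode.add, RingCode.mul, mul_add]
  right_distrib _ _ _ := by simp [ringCode, RingCode.add, RingCode.mul, add_mul]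

/-- The point of the space of countable rings given by a countable ring. -/
def ringPoint {R : Type*} [Ring R] (e : R ≃ ℕ) : RingSpace := ⟨ringCode e, isUnitalRing_ringCode e⟩

theorem smul_ringPoint_eq_iff {R S : Type*} [Ring R] [Ring S] (e : R ≃ ℕ) (e' : S ≃ ℕ)
    (φ : R ≃ S) (τ : Equiv.Perm ℕ) (hτ : ∀ q, τ (e q) = e' (φ q)) :
    τ • ringPoint e = ringPoint e' ↔ ∃ ψ : R ≃+* S, ψ.toEquiv = φ := by
  rw [smul_ringSpace_eq_iff]
  simp only [ringPoint, ringCode, RingCode.add, RingCode.mul, RingCode.neg, RingCode.zero,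
    RingCode.one, hτ, e'.injective.eq_iff]
  have hs : ∀ m, e'.symm (τ m) = φ (e.symm m) := fun m => by
    rw [Equiv.symm_apply_eq, ← hτ, Equiv.apply_symm_apply]
  simp only [hs]
  constructor
  · rintro ⟨hadd, hmul, -⟩
    refine ⟨{ φ with
      map_add' := fun q r => ?_
      map_mul' := fun q r => ?_ }, rfl⟩
    · simpa using hmul (e q) (e r)
    · simpa using hadd (e q) (e r)
  · rintro ⟨ψ, rfl⟩
    simp

theorem graph_spbReduces_ring : SPBReduces (Equiv.Perm ℕ) GraphSpace RingSpace := by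
  let e : RingDomain ≃ ℕ := nonempty_equiv_of_countable.some
  let f : GraphSpace → RingSpace := fun x =>
    ringPoint (R := GraphRing x.1) e
  have hf : Measurable f := by
    refine Measurable.subtype_mk (.prodMk ?_ (.prodMk ?_ (.prodMk ?_ (.prodMk ?_ ?_))))
    · exact measurable_const (a := (fun m n => e (e.symm m + e.symm n)))
    · refine measurable_pi_lambda _ fun m => measurable_pi_lambda _ fun n =>
        measurable_of_finite_dependence _
          ((e.symm m).2.1.support ∪ (e.symm n).2.1.support) fun x y h => ?_
      change e (GraphRing.mulFun x.1 (e.symm m) (e.symm n)) =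
        e (GraphRing.mulFun y.1 (e.symm m) (e.symm n))
      have hm := pairMap_congr (u := (e.symm m).2.1) fun p hp => h p (Finset.mem_union_left _ hp)
      have hn := pairMap_congr (u := (e.symm n).2.1) fun p hp => h p (Finset.mem_union_right _ hp)
      have hmn := pairMap_congr (u := (e.symm m).2.1 * (e.symm n).2.1) fun p hp =>
        h p (Finset.mem_union_left _ (Finsupp.support_mul_subset_left hp))
      simp only [GraphRing.mulFun, hm, hn, hmn]
    · exact measurable_const (a := (fun m => e (-e.symm m)))
    · exact measurable_const (a := (e 0))
    · exact measurable_const (a := (e (1, 0, 0)))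
  refine spbReduces_of_structure e f hf GraphRing.permHom GraphRing.permHom_injective
    (fun x y φ => ∃ ψ : GraphRing x.1 ≃+* GraphRing y.1, ψ.toEquiv = φ)
    (fun x y φ => smul_ringPoint_eq_iff (R := GraphRing x.1) (S := GraphRing y.1) e e φ _
      fun q => congrArg (fun r => e (φ r)) (e.symm_apply_apply q))
    (fun σ x y => ?_) ?_
  · rw [smul_graphSpace_eq_iff]
    constructor
    · rintro ⟨ψ, hψ⟩
      obtain ⟨τ, h, rfl⟩ := GraphRing.exists_perm ψ
      obtain rfl : τ = σ := GraphRing.permHom_injective hψ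
      exact h
    · exact fun h => ⟨GraphRing.permEquiv σ h, rfl⟩
  · rintro _ x y ⟨ψ, rfl⟩
    obtain ⟨τ, h, rfl⟩ := GraphRing.exists_perm ψ
    exact ⟨τ, rfl⟩

end InvariantDST

theorem mainTheorem8 :
    InvariantDST.SPBReduces (Equiv.Perm ℕ) InvariantDST.GraphSpace InvariantDST.POSpace ∧
    InvariantDST.SPBReduces (Equiv.Perm ℕ) InvariantDST.GraphSpace InvariantDST.SemigroupSpace ∧
    InvariantDST.SPBReduces (Equiv.Perm ℕ) InvariantDST.GraphSpace InvariantDST.RingSpace :=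
  ⟨InvariantDST.graph_spbReduces_po, InvariantDST.graph_spbReduces_semigroup,
    InvariantDST.graph_spbReduces_ring⟩
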